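/- Let $n\ge 2$ and $\lambda>0$. A \emph{convex body} in $\mathbb{R}^n$ is a compact convex set with non-empty interior. A convex body $K\subset\mathbb{R}^n$ is \emph{$\lambda$-convex} if for every $p\in\partial K$ there are a neighborhood $U_p$ of $p$ and a closed ball $B_{\lambda,p}$ of radius $1/\lambda$ such that $p\in\partial B_{\lambda,p}$ and $U_p\cap K\subset B_{\lambda,p}$. A \emph{$\lambda$-convex lens} is a convex body that is the intersection of two (possibly equal) closed balls of radius $1/\lambda$. The \emph{inradius} $r(K)$ of a convex body $K$ is the radius of a largest closed ball contained in $K$. The \emph{intrinsic volumes} $V_0(K),\dots,V_n(K)$ are the coefficients in the Steiner formula $$\mathrm{Vol}(K+\varepsilon \mathbf{B})=\sum_{j=0}^n \kappa_{n-j}V_j(K)\,\varepsilon^{n-j}\qquad(\varepsilon>0),$$ where $\mathbf{B}$ is the closed unit ball of $\mathbb{R}^n$ and $\kappa_m$ is the volume of the unit ball of $\mathbb{R}^m$; in particular $V_1(K)$ is the mean width of $K$ up to a positive factor depending only on $n$. Theorem. If $K\subset\mathbb{R}^n$ is a $\lambda$-convex body, $L\subset\mathbb{R}^n$ is a $\lambda$-convex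 lens, and $r(K)=r(L)$, then $$V_1(K)\le V_1(L),$$ with equality if and only if $K$ is a $\lambda$-convex lens. -/

import Mathlib

section ReverseInradius

open scoped Pointwise Topology

/-- A convex body in `ℝⁿ`: a compact convex set with non-empty interior. -/
def IsConvexBody {n : ℕ} (K : Set (EuclideanSpace ℝ (Fin n))) : Prop :=
  IsCompact K ∧ Convex ℝ K ∧ (interior K).Nonempty

/-- A `lam`-convex body: a convex body such that for every boundary point `p` there are a
neighbourhood `U` of `p` and a closed ball of radius `1 / lam` with `p` on its boundary sphere
that contains `U ∩ K`. -/
def IsLambdaConvexBody {n : ℕ} (lam : ℝ) (K : Set (EuclideanSpace ℝ (Fin n))) : Prop :=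
  IsConvexBody K ∧
    ∀ p ∈ frontier K, ∃ U ∈ 𝓝 p, ∃ c : EuclideanSpace ℝ (Fin n),
      p ∈ Metric.sphere c (1 / lam) ∧ U ∩ K ⊆ Metric.closedBall c (1 / lam)

/-- A `lam`-convex lens: a convex body that is the intersection of two closed balls of
radius `1 / lam`. -/
def IsLambdaConvexLens {n : ℕ} (lam : ℝ) (L : Set (EuclideanSpace ℝ (Fin n))) : Prop :=
  IsConvexBody L ∧
    ∃ c₁ c₂ : EuclideanSpace ℝ (Fin n),
      L = Metric.closedBall c₁ (1 / lam) ∩ Metric.closedBall c₂ (1 / lam)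

/-- The inradius: the largest radius of a closed ball contained in `K`. -/
noncomputable def inradius {n : ℕ} (K : Set (EuclideanSpace ℝ (Fin n))) : ℝ :=
  sSup {r : ℝ | 0 ≤ r ∧ ∃ c : EuclideanSpace ℝ (Fin n), Metric.closedBall c r ⊆ K}

/-- The volume `κ_m` of the unit ball of `ℝ^m` (so `κ_0 = 1`). -/
noncomputable def unitBallVolume (m : ℕ) : ℝ :=
  MeasureTheory.volume.real (Metric.closedBall (0 : EuclideanSpace ℝ (Fin m)) 1)

/-- `V 0, …, V n` are the coefficients in the Steiner formula
`Vol (K + ε B) = ∑_{j = 0}^{n} κ_{n-j} V_j ε^{n-j}` for all `ε > 0`; as there are no further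
coefficients, `V j` is set to `0` for `j > n`. There is at most one such `V`. -/
def IsSteinerCoefficients {n : ℕ} (K : Set (EuclideanSpace ℝ (Fin n))) (V : ℕ → ℝ) : Prop :=
  (∀ ε : ℝ, 0 < ε →
    MeasureTheory.volume.real (K + ε • Metric.closedBall (0 : EuclideanSpace ℝ (Fin n)) 1) =
      ∑ j ∈ Finset.range (n + 1), unitBallVolume (n - j) * V j * ε ^ (n - j)) ∧
  ∀ j, n < j → V j = 0

/-- The `j`-th intrinsic volume `V_j(K)` of a convex body `K`, the `j`-th coefficient in the
Steiner formula. -/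
noncomputable def intrinsicVolume {n : ℕ} (j : ℕ) (K : Set (EuclideanSpace ℝ (Fin n))) : ℝ :=
  Classical.epsilon (IsSteinerCoefficients K) j

end ReverseInradius

/-! ### Steiner's formula via the nearest point projection. -/

section Steiner

open MeasureTheory Metric Set Polynomial
open scoped Pointwise Topology RealInnerProductSpace NNReal

namespace ReverseInradius

variable {E : Type*} [NormedAddCommGroup E] [InnerProductSpace ℝ E]

/-! Up to a positive factor, `V_1` is the integral of the support function over the unit sphere.
Since `intrinsicVolume` is a choice of Steiner coefficients, their existence is proved first
(`exists_steiner_polynomial`); the relevant coefficient is then read off from large parallel bodies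
(`steiner_coeff_eq_integral_supportFun`).

Put `R = 1 / lam` and `d = R - r`, where `r` is the inradius and `o` the centre of an inball. The
contact normals of the inball have the origin in their convex hull (`zero_mem_convexHull_contact`).
At a contact normal `u` the supporting ball of radius `R` can only be the one centred at `o - d u`,
and by Blaschke's rolling theorem it contains all of `K`. So `K` lies in finitely many balls with
centres `o - d z_i`, where the unit vectors `z_i` satisfy `∑ w_i z_i = 0` for convex weights `w_i`
(`BalancedBalls`).

Let `φ` be `lensHalfWidth R d`: it is even, concave, and nonincreasing in `|s|`. If `M` and `-m` are
the extreme values of `⟪z_i, v⟫`, the width of `K` in direction `v` is at most `φ(M) + φ(m)`, and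
concavity together with the vanishing barycentre bounds this by `2 ∑ w_i φ(⟪z_i, v⟫)`
(`BalancedBalls.width_le`). Integrated over the sphere, every term contributes the same by rotation
invariance, and the total is at most that of the lens.

Equality in the integral forces equality of widths in every direction. In direction `z_i` it is
strict unless some `z_j = -z_i` (for `d > 0`), so `K` lies in a lens with the same integral and
hence equals it. -/

/-- `p` is the nearest point projection onto `K`, expressed by the obtuse angle criterion. -/
def IsNearestPointMap (K : Set E) (p : E → E) : Prop :=
  ∀ x, p x ∈ K ∧ ∀ w ∈ K, ⟪x - p x, w - p x⟫ ≤ 0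

lemma exists_isNearestPointMap [CompleteSpace E] {K : Set E} (hne : K.Nonempty)
    (hc : IsClosed K) (hconv : Convex ℝ K) : ∃ p : E → E, IsNearestPointMap K p := by
  choose p hp hmin using exists_norm_eq_iInf_of_complete_convex hne hc.isComplete hconv
  exact ⟨p, fun x => ⟨hp x, (norm_eq_iInf_iff_real_inner_le_zero hconv (hp x)).1 (hmin x)⟩⟩

namespace IsNearestPointMap

variable {K : Set E} {p : E → E} (hp : IsNearestPointMap K p)
include hp

lemma norm_sq_le_inner (x y : E) : ‖p x - p y‖ ^ 2 ≤ ⟪x - y, p x - p y⟫ := by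
  have h1 := (hp x).2 _ (hp y).1
  have h2 := (hp y).2 _ (hp x).1
  have : ⟪x - y, p x - p y⟫ - ‖p x - p y‖ ^ 2
      = -(⟪x - p x, p y - p x⟫ + ⟪y - p y, p x - p y⟫) := by
    rw [← real_inner_self_eq_norm_sq]
    simp only [inner_sub_left, inner_sub_right]
    ring
  linarith

lemma lipschitzWith : LipschitzWith 1 p := by
  refine LipschitzWith.of_dist_le_mul fun x y => ?_
  rw [dist_eq_norm, dist_eq_norm, NNReal.coe_one, one_mul]
  have h := (hp.norm_sq_le_inner x y).trans (real_inner_le_norm _ _)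
  by_contra! hlt
  nlinarith [norm_nonneg (x - y)]

lemma eq_of_forall_inner_le {x q : E} (hq : q ∈ K) (h : ∀ w ∈ K, ⟪x - q, w - q⟫ ≤ 0) :
    p x = q := by
  have h1 := (hp x).2 _ hq
  have h2 := h _ (hp x).1
  have : ‖p x - q‖ ^ 2 = ⟪x - p x, q - p x⟫ + ⟪x - q, p x - q⟫ := by
    rw [← real_inner_self_eq_norm_sq]
    simp only [inner_sub_left, inner_sub_right]
    ring
  have h0 : ‖p x - q‖ ^ 2 = 0 := le_antisymm (by linarith) (by positivity)
  simpa [sub_eq_zero] using h0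

lemma apply_add_smul (x : E) {t : ℝ} (ht : 0 ≤ t) : p (p x + t • (x - p x)) = p x := by
  refine hp.eq_of_forall_inner_le (hp x).1 fun w hw => ?_
  rw [add_sub_cancel_left, real_inner_smul_left]
  exact mul_nonpos_of_nonneg_of_nonpos ht ((hp x).2 w hw)

lemma add_smul_closedBall_eq {t : ℝ} (ht : 0 < t) :
    K + t • closedBall (0 : E) 1 = {x | ‖x - p x‖ ≤ t} := by
  have hsm : t • closedBall (0 : E) 1 = closedBall 0 t := by
    rw [smul_unitClosedBall_of_nonneg ht.le]
  rw [hsm]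
  ext x
  constructor
  · rintro ⟨k, hk, b, hb, rfl⟩
    rw [mem_closedBall_zero_iff] at hb
    refine le_trans ?_ hb
    have h := (hp (k + b)).2 k hk
    set y := k + b
    have e : ‖b‖ ^ 2 = ‖y - p y‖ ^ 2 + ‖k - p y‖ ^ 2 - 2 * ⟪y - p y, k - p y⟫ := by
      have : b = (y - p y) - (k - p y) := by simp [y]
      rw [this, norm_sub_sq_real]
      ring
    have : ‖y - p y‖ ^ 2 ≤ ‖b‖ ^ 2 := by nlinarith [sq_nonneg ‖k - p y‖]
    exact le_of_sq_le_sq this (norm_nonneg _)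
  · intro hx
    exact ⟨p x, (hp x).1, x - p x, by simpa using hx, by simp⟩

/-- The projection is constant along each normal ray, so dilating by `t` from the foot point is
undone by dilating by `t⁻¹`. -/
lemma image_eq {t : ℝ} (ht : 0 < t) :
    (fun x => p x + t • (x - p x)) '' {x | ‖x - p x‖ ≤ 1} = {x | ‖x - p x‖ ≤ t} := by
  ext y
  constructor
  · rintro ⟨x, hx, rfl⟩
    simp only [mem_ofPred_eq] at hx ⊢
    rw [hp.apply_add_smul x ht.le, add_sub_cancel_left, norm_smul, Real.norm_of_nonneg ht.le]
    nlinarith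
  · intro hy
    refine ⟨p y + t⁻¹ • (y - p y), ?_, ?_⟩
    · simp only [mem_ofPred_eq] at hy ⊢
      rw [hp.apply_add_smul y (by positivity), add_sub_cancel_left, norm_smul, Real.norm_of_nonneg
        (by positivity), inv_mul_le_iff₀ ht]
      simpa using hy
    · simp only
      rw [hp.apply_add_smul y (by positivity), add_sub_cancel_left, smul_smul,
        mul_inv_cancel₀ ht.ne', one_smul, add_sub_cancel]

lemma injective_add_smul {t : ℝ} (ht : 0 < t) :
    Function.Injective (fun x => p x + t • (x - p x)) := by
  refine Function.LeftInverse.injective (g := fun x => p x + t⁻¹ • (x - p x)) fun x => ?_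
  simp only
  rw [hp.apply_add_smul x ht.le, add_sub_cancel_left, smul_smul, inv_mul_cancel₀ ht.ne',
    one_smul, add_sub_cancel]

/-- The infinitesimal form of firm nonexpansiveness, `norm_sq_le_inner`. -/
lemma inner_fderiv_nonneg {x : E} {A : E →L[ℝ] E} (hA : HasFDerivAt p A x) (v : E) :
    ‖A v‖ ^ 2 ≤ ⟪v, A v⟫ := by
  have h := (hA.hasLineDerivAt v).tendsto_slope_zero_right
  have h1 : Filter.Tendsto (fun t : ℝ => ‖t⁻¹ • (p (x + t • v) - p x)‖ ^ 2) (𝓝[>] 0)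
    (𝓝 (‖A v‖ ^ 2)) := (h.norm).pow 2
  have h2 : Filter.Tendsto (fun t : ℝ => ⟪v, t⁻¹ • (p (x + t • v) - p x)⟫) (𝓝[>] 0)
    (𝓝 ⟪v, A v⟫) := tendsto_const_nhds.inner h
  refine le_of_tendsto_of_tendsto h1 h2 ?_
  filter_upwards [self_mem_nhdsWithin] with t ht
  have ht : 0 < t := ht
  have := hp.norm_sq_le_inner (x + t • v) x
  rw [add_sub_cancel_left, real_inner_smul_left] at this
  rw [norm_smul, real_inner_smul_right, mul_pow, Real.norm_of_nonneg (by positivity)]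
  calc t⁻¹ ^ 2 * ‖p (x + t • v) - p x‖ ^ 2 ≤ t⁻¹ ^ 2 * (t * ⟪v, p (x + t • v) - p x⟫) := by gcongr
    _ = _ := by field_simp

end IsNearestPointMap

/-- The segment from the identity to `A` stays inside the positive, hence invertible, maps, so the
determinant keeps its sign. -/
lemma det_pos_of_inner_pos [FiniteDimensional ℝ E] (A : E →L[ℝ] E)
    (hA : ∀ v ≠ 0, 0 < ⟪v, A v⟫) : 0 < A.det := by
  let f : ℝ → ℝ := fun s => (s • A + (1 - s) • ContinuousLinearMap.id ℝ E).det
  have hf : Continuous f := ContinuousLinearMap.continuous_det.comp (by fun_prop)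
  have hne : ∀ s ∈ Icc (0 : ℝ) 1, f s ≠ 0 := by
    intro s hs h0
    obtain ⟨v, hv, hv0⟩ : ∃ v, (s • A + (1 - s) • ContinuousLinearMap.id ℝ E) v = 0 ∧ v ≠ 0 := by
      have := LinearMap.bot_lt_ker_of_det_eq_zero (f := ((s • A + (1 - s) • ContinuousLinearMap.id ℝ E :
        E →L[ℝ] E) : E →ₗ[ℝ] E)) h0
      obtain ⟨v, hv, hv0⟩ := (Submodule.ne_bot_iff _).1 this.ne'
      exact ⟨v, hv, hv0⟩
    have h1 : ⟪v, (s • A + (1 - s) • ContinuousLinearMap.id ℝ E) v⟫ = 0 := by rw [hv, inner_zero_right]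
    simp only [add_apply, smul_apply, ContinuousLinearMap.coe_id', id_eq, inner_add_right,
      real_inner_smul_right, real_inner_self_eq_norm_sq] at h1
    have h2 := hA v hv0
    have h3 : 0 < ‖v‖ ^ 2 := by positivity
    rcases hs.1.eq_or_lt with h | h
    · subst h; simp at h1; exact hv0 h1
    · nlinarith [mul_pos h h2, mul_nonneg (sub_nonneg.2 hs.2) h3.le]
  have h0 : f 0 = 1 := by simp [f, ContinuousLinearMap.det]
  have h1 : f 1 = A.det := by simp [f]
  by_contra! hle
  rw [← h1] at hle
  obtain ⟨s, hs, hs0⟩ := intermediate_value_Icc' zero_le_one hf.continuousOn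
    (⟨hle, by rw [h0]; norm_num⟩ : (0 : ℝ) ∈ Icc (f 1) (f 0))
  exact hne s hs hs0

lemma exists_polynomial_det [FiniteDimensional ℝ E] (A B : E →L[ℝ] E) :
    ∃ P : ℝ[X], P.natDegree ≤ Module.finrank ℝ E ∧ ∀ t : ℝ, P.eval t = (A + t • B).det := by
  classical
  let b := Module.finBasis ℝ E
  refine ⟨Matrix.det ((X : ℝ[X]) • (LinearMap.toMatrix b b (B : E →ₗ[ℝ] E)).map C
    + (LinearMap.toMatrix b b (A : E →ₗ[ℝ] E)).map C), ?_, fun t => ?_⟩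
  · simpa using natDegree_det_X_add_C_le (LinearMap.toMatrix b b (B : E →ₗ[ℝ] E))
      (LinearMap.toMatrix b b (A : E →ₗ[ℝ] E))
  · rw [ContinuousLinearMap.det, ← LinearMap.det_toMatrix b, ← coe_evalRingHom, RingHom.map_det]
    congr 1
    ext i j
    simp [add_comm, mul_comm t]

/-- By Lagrange interpolation the coefficients are fixed linear combinations of values, which
transfers integrability from values to coefficients. The nodes start at `1` because only positive
parameters occur later. -/
lemma polynomial_coeff_eq_sum {n : ℕ} (P : ℝ[X]) (hP : P.natDegree ≤ n) (j : ℕ) :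
    P.coeff j = ∑ i ∈ Finset.range (n + 1), P.eval ((i : ℝ) + 1) *
      (Lagrange.basis (Finset.range (n + 1)) (fun i : ℕ => (i : ℝ) + 1) i).coeff j := by
  have h := Lagrange.eq_interpolate (s := Finset.range (n + 1)) (v := fun i : ℕ => (i : ℝ) + 1)
    (f := P) (fun a _ b _ hab => by simpa using hab) (by
      rw [Finset.card_range]
      exact (Polynomial.degree_le_natDegree).trans_lt (by exact_mod_cast Nat.lt_succ_of_le hP))
  conv_lhs => rw [h]
  simp [Lagrange.interpolate_apply]

/-- Steiner's theorem: the volume of the outer parallel body is a polynomial. -/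
theorem exists_steiner_polynomial [FiniteDimensional ℝ E] [MeasurableSpace E] [BorelSpace E]
    {K : Set E} (hne : K.Nonempty) (hK : IsCompact K) (hconv : Convex ℝ K) :
    ∃ c : ℕ → ℝ, ∀ t : ℝ, 0 < t → (volume : Measure E).real (K + t • closedBall (0 : E) 1) =
      ∑ j ∈ Finset.range (Module.finrank ℝ E + 1), c j * t ^ j := by
  obtain ⟨p, hp⟩ := exists_isNearestPointMap hne hK.isClosed hconv
  have hpc : Continuous p := hp.lipschitzWith.continuous
  set D : Set E := {x | DifferentiableAt ℝ p x}
  have hD : MeasurableSet D := measurableSet_of_differentiableAt ℝ p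
  have hDnull : (volume : Measure E) Dᶜ = 0 := hp.lipschitzWith.ae_differentiableAt
  set S : Set E := {x | ‖x - p x‖ ≤ 1}
  have hS : MeasurableSet S :=
    (isClosed_le (by fun_prop) continuous_const).measurableSet
  -- `T t` carries the unit parallel body onto the one of radius `t`. Its derivative is affine in
  -- `t`, so the Jacobian is a polynomial in `t` for each fixed `x`.
  set T : ℝ → E → E := fun t x => p x + t • (x - p x)
  set T' : ℝ → E → (E →L[ℝ] E) := fun t x =>
    fderiv ℝ p x + t • (ContinuousLinearMap.id ℝ E - fderiv ℝ p x)
  have hT' : ∀ t, ∀ x ∈ S ∩ D, HasFDerivWithinAt (T t) (T' t x) (S ∩ D) x := by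
    intro t x hx
    have h : HasFDerivAt p (fderiv ℝ p x) x := hx.2.hasFDerivAt
    exact (h.add (((hasFDerivAt_id x).sub h).const_smul t)).hasFDerivWithinAt
  have hdet : ∀ t > 0, ∀ x ∈ S ∩ D, 0 < (T' t x).det := by
    intro t ht x hx
    refine det_pos_of_inner_pos _ fun v hv => ?_
    have h1 := hp.inner_fderiv_nonneg (hx.2.hasFDerivAt) v
    have h2 := real_inner_le_norm v (fderiv ℝ p x v)
    have h3 : 0 < ‖v‖ := norm_pos_iff.2 hv
    simp only [T', add_apply, smul_apply, sub_apply, ContinuousLinearMap.coe_id', id_eq,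
      inner_add_right, real_inner_smul_right, inner_sub_right, real_inner_self_eq_norm_sq]
    set q := ⟪v, fderiv ℝ p x v⟫
    have hq0 : 0 ≤ q := le_trans (by positivity) h1
    have hle : ‖fderiv ℝ p x v‖ ≤ ‖v‖ := by
      by_contra! hlt
      nlinarith
    have hq1 : q ≤ ‖v‖ ^ 2 := by nlinarith
    rcases hq0.eq_or_lt with h | h
    · rw [← h]; simp; positivity
    · nlinarith [mul_nonneg ht.le (sub_nonneg.2 hq1)]
  have hTlip : ∀ t, ∃ C, LipschitzWith C (T t) := fun t =>
    ⟨_, hp.lipschitzWith.add ((lipschitzWith_smul t).comp (LipschitzWith.id.sub hp.lipschitzWith))⟩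
  have himg : ∀ t > 0, (volume : Measure E) (T t '' (S ∩ D))
      = volume (K + t • closedBall (0 : E) 1) := by
    intro t ht
    rw [hp.add_smul_closedBall_eq ht, ← hp.image_eq ht]
    change _ = volume (T t '' S)
    refine le_antisymm (measure_mono (image_mono inter_subset_left)) ?_
    -- A Lipschitz map sends null sets to null sets; this is seen through the Hausdorff measure of
    -- full dimension.
    have hN : volume (T t '' Dᶜ) = 0 := by
      obtain ⟨C, hC⟩ := hTlip t
      have hac : (volume : Measure E) ≪ Measure.hausdorffMeasure (Module.finrank ℝ E : ℝ) :=
        Measure.absolutelyContinuous_isAddHaarMeasure _ _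
      have hac' : Measure.hausdorffMeasure (Module.finrank ℝ E : ℝ) ≪ (volume : Measure E) :=
        Measure.absolutelyContinuous_isAddHaarMeasure _ _
      refine hac (le_antisymm ((hC.hausdorffMeasure_image_le (by positivity) _).trans ?_) zero_le)
      rw [hac' hDnull, mul_zero]
    calc volume (T t '' S) ≤ volume (T t '' (S ∩ D) ∪ T t '' Dᶜ) := by
          rw [← image_union]
          refine measure_mono (image_mono fun x hx => ?_)
          by_cases h : x ∈ D
          · exact Or.inl ⟨hx, h⟩
          · exact Or.inr h
      _ ≤ _ := (measure_union_le _ _).trans (by rw [hN, add_zero])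
  have hfin : ∀ t > (0 : ℝ), (volume : Measure E) (K + t • closedBall (0 : E) 1) < ⊤ := fun t _ =>
    (hK.add ((isCompact_closedBall 0 1).smul t)).measure_lt_top
  have hinj : ∀ t > 0, InjOn (T t) (S ∩ D) := fun t ht => (hp.injective_add_smul ht).injOn
  have hint : ∀ t > 0, IntegrableOn (fun x => (T' t x).det) (S ∩ D) := by
    intro t ht
    have h := (integrableOn_image_iff_integrableOn_abs_det_fderiv_smul volume (hS.inter hD) (hT' t)
      (hinj t ht) (fun _ => (1 : ℝ))).1 (by
        rw [integrableOn_const_iff]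
        right
        rw [himg t ht]
        exact hfin t ht)
    refine h.congr_fun (fun x hx => ?_) (hS.inter hD)
    simp [abs_of_pos (hdet t ht x hx)]
  have hvol : ∀ t > (0 : ℝ), (volume : Measure E).real (K + t • closedBall (0 : E) 1) =
      ∫ x in S ∩ D, (T' t x).det := by
    intro t ht
    have h := integral_image_eq_integral_abs_det_fderiv_smul volume (hS.inter hD) (hT' t)
      (hinj t ht) (fun _ => (1 : ℝ))
    rw [setIntegral_const, smul_eq_mul, mul_one, measureReal_def, himg t ht] at h
    rw [measureReal_def, h]
    refine setIntegral_congr_fun (hS.inter hD) fun x hx => ?_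
    simp [abs_of_pos (hdet t ht x hx)]
  choose P hPdeg hPeval using fun x => exists_polynomial_det (fderiv ℝ p x)
    (ContinuousLinearMap.id ℝ E - fderiv ℝ p x)
  have hcoeff : ∀ j, IntegrableOn (fun x => (P x).coeff j) (S ∩ D) := by
    intro j
    have : (fun x => (P x).coeff j) = fun x => ∑ i ∈ Finset.range (Module.finrank ℝ E + 1),
        (T' ((i : ℝ) + 1) x).det *
        (Lagrange.basis (Finset.range (Module.finrank ℝ E + 1))
          (fun i : ℕ => (i : ℝ) + 1) i).coeff j := by
      funext x
      rw [polynomial_coeff_eq_sum (P x) (hPdeg x)]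
      simp only [hPeval, T']
    rw [this]
    exact integrable_finsetSum _ fun i _ => (hint _ (by positivity)).mul_const _
  refine ⟨fun j => ∫ x in S ∩ D, (P x).coeff j, fun t ht => ?_⟩
  rw [hvol t ht]
  have : (fun x => (T' t x).det) = fun x =>
      ∑ j ∈ Finset.range (Module.finrank ℝ E + 1), (P x).coeff j * t ^ j := by
    funext x
    rw [← hPeval x t, Polynomial.eval_eq_sum_range' (Nat.lt_succ_of_le (hPdeg x))]
  rw [this, integral_finsetSum _ fun j _ => (hcoeff j).mul_const _]
  simp only [integral_mul_const]

end ReverseInradius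

end Steiner

/-! ### The support function and its integral as a Steiner coefficient. -/

section MeanWidth

open MeasureTheory Metric Set Polynomial
open scoped Pointwise Topology RealInnerProductSpace NNReal

namespace ReverseInradius

variable {E : Type*} [NormedAddCommGroup E] [InnerProductSpace ℝ E]

/-- The support function of a set. -/
noncomputable def supportFun (K : Set E) (v : E) : ℝ := sSup ((fun y => ⟪y, v⟫) '' K)

section SupportFun

variable {K : Set E}

lemma bddAbove_image_inner (hK : IsCompact K) (v : E) :
    BddAbove ((fun y => ⟪y, v⟫) '' K) :=
  (hK.image (by fun_prop : Continuous fun y : E => ⟪y, v⟫)).bddAbove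

lemma inner_le_supportFun (hK : IsCompact K) (v : E) {y : E} (hy : y ∈ K) :
    ⟪y, v⟫ ≤ supportFun K v :=
  le_csSup (bddAbove_image_inner hK v) (mem_image_of_mem _ hy)

lemma supportFun_le (hne : K.Nonempty) {v : E} {a : ℝ} (h : ∀ y ∈ K, ⟪y, v⟫ ≤ a) :
    supportFun K v ≤ a :=
  csSup_le (hne.image _) (by rintro _ ⟨y, hy, rfl⟩; exact h y hy)

lemma exists_inner_eq_supportFun (hK : IsCompact K) (hne : K.Nonempty) (v : E) :
    ∃ y ∈ K, ⟪y, v⟫ = supportFun K v := by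
  obtain ⟨y, hy, h⟩ := (hK.image (by fun_prop : Continuous fun y : E => ⟪y, v⟫)).sSup_mem
    (hne.image _)
  exact ⟨y, hy, h⟩

lemma continuous_supportFun (hK : IsCompact K) : Continuous (supportFun K) :=
  hK.continuous_sSup (f := fun v y => ⟪y, v⟫) (by fun_prop)

lemma abs_supportFun_le (hK : IsCompact K) (hne : K.Nonempty) {D : ℝ} (hD : ∀ y ∈ K, ‖y‖ ≤ D)
    {v : E} (hv : ‖v‖ = 1) : |supportFun K v| ≤ D := by
  obtain ⟨y, hy, h⟩ := exists_inner_eq_supportFun hK hne v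
  rw [← h]
  refine (abs_real_inner_le_norm y v).trans ?_
  rw [hv, mul_one]
  exact hD y hy

lemma supportFun_mono {K' : Set E} (hK' : IsCompact K') (hne : K.Nonempty)
    (h : K ⊆ K') (v : E) : supportFun K v ≤ supportFun K' v :=
  supportFun_le hne fun _ hy => inner_le_supportFun hK' v (h hy)

/-- A point outside `K` violates the inequality in the direction from its nearest point to itself.
-/
lemma mem_of_forall_inner_le_supportFun [CompleteSpace E] (hK : IsCompact K)
    (hconv : Convex ℝ K) (hne : K.Nonempty) {x : E}
    (h : ∀ v : E, ‖v‖ = 1 → ⟪x, v⟫ ≤ supportFun K v) : x ∈ K := by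
  obtain ⟨p, hp⟩ := exists_isNearestPointMap hne hK.isClosed hconv
  by_contra hx
  have hne' : x - p x ≠ 0 := fun h0 => hx (by rw [sub_eq_zero.1 h0]; exact (hp x).1)
  have hpos : 0 < ‖x - p x‖ := norm_pos_iff.2 hne'
  have h1 := h (‖x - p x‖⁻¹ • (x - p x)) (by rw [norm_smul, norm_inv, norm_norm,
    inv_mul_cancel₀ hpos.ne'])
  have h2 : supportFun K (‖x - p x‖⁻¹ • (x - p x)) ≤ ⟪p x, ‖x - p x‖⁻¹ • (x - p x)⟫ := by
    refine supportFun_le hne fun y hy => ?_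
    have := (hp x).2 y hy
    rw [real_inner_comm, inner_sub_left] at this
    rw [real_inner_smul_right, real_inner_smul_right]
    gcongr
    linarith
  have h3 := h1.trans h2
  rw [← sub_nonpos, ← inner_sub_left, real_inner_smul_right, real_inner_self_eq_norm_sq] at h3
  have : 0 < ‖x - p x‖⁻¹ * ‖x - p x‖ ^ 2 := by positivity
  linarith

end SupportFun

section Polar

/-- The open star body with radial function `g`, punctured at the origin. -/
def puncturedStar (g : sphere (0 : E) 1 → ℝ) : Set E :=
  (↑) '' (homeomorphUnitSphereProd E ⁻¹' {q | (q.2 : ℝ) < g q.1})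

lemma mem_puncturedStar {g : sphere (0 : E) 1 → ℝ} {x : E} :
    x ∈ puncturedStar g ↔
      ∃ u : sphere (0 : E) 1, x = ‖x‖ • (u : E) ∧ 0 < ‖x‖ ∧ ‖x‖ < g u := by
  constructor
  · rintro ⟨⟨x, hx⟩, h, rfl⟩
    have hx' : 0 < ‖x‖ := norm_pos_iff.2 hx
    refine ⟨(homeomorphUnitSphereProd E ⟨x, hx⟩).1, ?_, hx', ?_⟩
    · simp [smul_smul, hx'.ne']
    · simpa using h
  · rintro ⟨u, hxu, hx0, hx⟩
    have hx' : x ≠ 0 := norm_pos_iff.1 hx0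
    refine ⟨⟨x, hx'⟩, ?_, rfl⟩
    have : (homeomorphUnitSphereProd E ⟨x, hx'⟩).1 = u := by
      apply Subtype.ext
      simp only [homeomorphUnitSphereProd_apply_fst_coe]
      nth_rw 2 [hxu]
      rw [smul_smul, inv_mul_cancel₀ hx0.ne', one_smul]
    simp only [mem_preimage, mem_ofPred_eq, this]
    simpa using hx

/-- Integration in polar coordinates. -/
lemma volume_puncturedStar [FiniteDimensional ℝ E] [MeasurableSpace E] [BorelSpace E]
    [Nontrivial E] {g : sphere (0 : E) 1 → ℝ} (hg : Continuous g)
    (hpos : ∀ u, 0 < g u) : (volume : Measure E).real (puncturedStar g) =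
      (∫ u, g u ^ Module.finrank ℝ E ∂(volume : Measure E).toSphere) / Module.finrank ℝ E := by
  have hdim : 0 < Module.finrank ℝ E := Module.finrank_pos
  have hQ : MeasurableSet {q : sphere (0 : E) 1 × Ioi (0 : ℝ) | (q.2 : ℝ) < g q.1} :=
    (isOpen_lt (by fun_prop) (by fun_prop)).measurableSet
  have h0 : (volume : Measure E) (puncturedStar g)
      = ∫⁻ u, ENNReal.ofReal (g u ^ Module.finrank ℝ E / Module.finrank ℝ E)
        ∂(volume : Measure E).toSphere := by
    have h := ((volume : Measure E).measurePreserving_homeomorphUnitSphereProd).measure_preimage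
      hQ.nullMeasurableSet
    rw [comap_subtype_coe_apply (measurableSet_singleton _).compl] at h
    rw [puncturedStar, h, Measure.prod_apply hQ]
    refine lintegral_congr fun u => ?_
    have : (Prod.mk u ⁻¹' {q : sphere (0 : E) 1 × Ioi (0 : ℝ) | (q.2 : ℝ) < g q.1})
        = Iio (⟨g u, hpos u⟩ : Ioi (0 : ℝ)) := by
      ext r
      simp [← Subtype.coe_lt_coe]
    rw [this, Measure.volumeIoiPow_apply_Iio, Nat.sub_add_cancel hdim, Nat.cast_pred hdim,
      sub_add_cancel]
  have hint : Integrable (fun u => g u ^ Module.finrank ℝ E / Module.finrank ℝ E)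
      (volume : Measure E).toSphere :=
    Continuous.integrable_of_hasCompactSupport (by fun_prop) (HasCompactSupport.of_compactSpace _)
  rw [measureReal_def, h0, ← ofReal_integral_eq_lintegral_ofReal hint
    (ae_of_all _ fun u => by have := hpos u; positivity), ENNReal.toReal_ofReal
    (integral_nonneg fun u => by have := hpos u; positivity), integral_div]

end Polar

lemma exists_abs_one_add_pow_sub_le (n : ℕ) :
    ∃ C : ℝ, 0 ≤ C ∧ ∀ x : ℝ, |x| ≤ 1 → |(1 + x) ^ n - 1 - n * x| ≤ C * x ^ 2 := by
  induction n with
  | zero => exact ⟨0, le_rfl, fun x _ => by simp⟩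
  | succ n ih =>
    obtain ⟨C, hC0, hC⟩ := ih
    refine ⟨2 * C + n, by positivity, fun x hx => ?_⟩
    have e : (1 + x) ^ (n + 1) - 1 - ((n + 1 : ℕ) : ℝ) * x
        = (1 + x) * ((1 + x) ^ n - 1 - n * x) + n * x ^ 2 := by push_cast; ring
    rw [e]
    have h1 : |1 + x| ≤ 2 := (abs_add_le _ _).trans (by rw [abs_one]; linarith)
    calc _ ≤ |(1 + x) * ((1 + x) ^ n - 1 - n * x)| + |n * x ^ 2| := abs_add_le _ _
      _ = |1 + x| * |(1 + x) ^ n - 1 - n * x| + n * x ^ 2 := by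
          rw [abs_mul, abs_of_nonneg (by positivity : 0 ≤ (n : ℝ) * x ^ 2)]
      _ ≤ 2 * (C * x ^ 2) + n * x ^ 2 := by
          gcongr
          exact hC x hx
      _ = _ := by ring

lemma eval_zero_eq_zero_of_abs_le {P : ℝ[X]} {C δ : ℝ} (hδ : 0 < δ)
    (h : ∀ t, 0 < t → t < δ → |P.eval t| ≤ C * t) : P.eval 0 = 0 := by
  have h1 : Filter.Tendsto (fun t => |P.eval t|) (𝓝[>] 0) (𝓝 |P.eval 0|) :=
    (P.continuous.abs.tendsto 0).mono_left nhdsWithin_le_nhds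
  have h2 : Filter.Tendsto (fun t => C * t) (𝓝[>] 0) (𝓝 (C * 0)) :=
    ((continuous_const.mul continuous_id).tendsto 0).mono_left nhdsWithin_le_nhds
  rw [mul_zero] at h2
  have := le_of_tendsto_of_tendsto h1 h2 (by
    filter_upwards [Ioo_mem_nhdsGT hδ] with t ht using h t ht.1 ht.2)
  exact abs_nonpos_iff.1 this

lemma coeff_one_eq_zero_of_abs_le {P : ℝ[X]} {C δ : ℝ} (hδ : 0 < δ)
    (h : ∀ t, 0 < t → t < δ → |P.eval t| ≤ C * t ^ 2) : P.coeff 1 = 0 := by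
  have hC : ∀ t, 0 < t → t < δ → 0 ≤ C := fun t h0 h1 => by
    have := (abs_nonneg _).trans (h t h0 h1)
    by_contra! hc
    nlinarith [pow_pos h0 2]
  have h0 : P.eval 0 = 0 := by
    refine eval_zero_eq_zero_of_abs_le (C := C) (δ := min δ 1) (by positivity) fun t ht0 ht1 => ?_
    have h1 := ht1.trans_le (min_le_left _ _)
    have h2 := ht1.trans_le (min_le_right _ _)
    refine (h t ht0 h1).trans ?_
    have := hC t ht0 h1
    gcongr
    nlinarith
  have e : ∀ t, P.eval t = t * P.divX.eval t := fun t => by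
    conv_lhs => rw [← P.divX_mul_X_add]
    rw [coeff_zero_eq_eval_zero, h0]
    simp [mul_comm]
  have h1 : P.divX.eval 0 = 0 := by
    refine eval_zero_eq_zero_of_abs_le (C := C) hδ fun t ht0 ht1 => ?_
    have := h t ht0 ht1
    rw [e, abs_mul, abs_of_pos ht0, pow_two] at this
    have : t * |P.divX.eval t| ≤ t * (C * t) := by linarith
    exact le_of_mul_le_mul_left this ht0
  rwa [← coeff_zero_eq_eval_zero, coeff_divX] at h1

section Parallel

variable [FiniteDimensional ℝ E] [MeasurableSpace E] [BorelSpace E] [Nontrivial E]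

/-- With `ε = t⁻¹` large, `K + εB` is squeezed between star bodies with radial functions `h + ε ± D²
/ ε`, where `h` is the support function and `D` bounds the norms in `K`. Their volumes agree to
first order in `t` after scaling by `t ^ n`. -/
lemma exists_abs_volume_parallel_sub_le {K : Set E} (hne : K.Nonempty) (hK : IsCompact K) :
    ∃ C δ : ℝ, 0 < δ ∧ ∀ t, 0 < t → t < δ →
      |t ^ Module.finrank ℝ E * (volume : Measure E).real (K + t⁻¹ • closedBall (0 : E) 1)
        - ((volume : Measure E).toSphere.real univ / Module.finrank ℝ E
          + (∫ u, supportFun K u ∂(volume : Measure E).toSphere) * t)| ≤ C * t ^ 2 := by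
  set n := Module.finrank ℝ E
  have hn : 0 < (n : ℝ) := by exact_mod_cast (Module.finrank_pos : 0 < Module.finrank ℝ E)
  set σ := (volume : Measure E).toSphere
  obtain ⟨D, hD0, hD⟩ : ∃ D > 0, ∀ y ∈ K, ‖y‖ ≤ D := by
    obtain ⟨D, hD⟩ := hK.isBounded.exists_norm_le
    exact ⟨max D 1, by positivity, fun y hy => (hD y hy).trans (le_max_left _ _)⟩
  obtain ⟨C, hC0, hC⟩ := exists_abs_one_add_pow_sub_le n
  set h : sphere (0 : E) 1 → ℝ := fun u => supportFun K u
  have hh : Continuous h := (continuous_supportFun hK).comp continuous_subtype_val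
  have hunorm : ∀ u : sphere (0 : E) 1, ‖(u : E)‖ = 1 := fun u => by simp
  have hhD : ∀ u, |h u| ≤ D := fun u => abs_supportFun_le hK hne hD (hunorm u)
  have hintc : ∀ f : sphere (0 : E) 1 → ℝ, Continuous f → Integrable f σ := fun f hf =>
    hf.integrable_of_hasCompactSupport (HasCompactSupport.of_compactSpace _)
  set M : ℝ := (n * D ^ 2 + C * (2 * D) ^ 2)
  -- The sign `s = -1` serves the inner star body, `s = 1` the outer one.
  have key : ∀ t, 0 < t → t * D ≤ 1 / 2 → ∀ s : ℝ, |s| ≤ 1 →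
      |t ^ n * (∫ u, (h u + t⁻¹ + s * (D ^ 2 * t)) ^ n ∂σ) / n
        - (σ.real univ / n + (∫ u, h u ∂σ) * t)| ≤ σ.real univ * M / n * t ^ 2 := by
    intro t ht htD s hs
    have e : t ^ n * (∫ u, (h u + t⁻¹ + s * (D ^ 2 * t)) ^ n ∂σ) / n
        - (σ.real univ / n + (∫ u, h u ∂σ) * t)
        = (∫ u, ((1 + (t * h u + s * (D * t) ^ 2)) ^ n - 1 - n * (t * h u)) ∂σ) / n := by
      rw [integral_sub (hintc _ (by fun_prop)) (hintc _ (by fun_prop)),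
        integral_sub (hintc _ (by fun_prop)) (hintc _ (by fun_prop)), integral_const,
        integral_const_mul, integral_const_mul, smul_eq_mul, mul_one, ← integral_const_mul]
      have : ∀ u, t ^ n * (h u + t⁻¹ + s * (D ^ 2 * t)) ^ n
          = (1 + (t * h u + s * (D * t) ^ 2)) ^ n := fun u => by
        rw [← mul_pow]
        congr 1
        field_simp
        ring
      simp only [this]
      field_simp
      ring
    rw [e, abs_div, abs_of_pos hn, div_mul_eq_mul_div]
    gcongr
    calc |∫ u, ((1 + (t * h u + s * (D * t) ^ 2)) ^ n - 1 - n * (t * h u)) ∂σ|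
        ≤ (M * t ^ 2) * σ.real univ := by
          rw [← Real.norm_eq_abs]
          refine norm_integral_le_of_norm_le_const (μ := σ) (ae_of_all _ fun u => ?_)
          set x := t * h u + s * (D * t) ^ 2
          have hx : |x| ≤ 2 * D * t := by
            calc |x| ≤ |t * h u| + |s * (D * t) ^ 2| := abs_add_le _ _
              _ = t * |h u| + |s| * (D * t) ^ 2 := by
                rw [abs_mul, abs_mul, abs_of_pos ht, abs_of_nonneg (sq_nonneg (D * t))]
              _ ≤ t * D + 1 * (D * t * 1) := by
                gcongr
                · exact hhD u
                · rw [pow_two]; gcongr; linarith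
              _ = _ := by ring
          have hx1 : |x| ≤ 1 := by linarith
          have h1 := hC x hx1
          have h2 : x ^ 2 ≤ (2 * D * t) ^ 2 := by
            rw [← sq_abs x]; gcongr
          have e2 : (1 + x) ^ n - 1 - n * (t * h u)
              = ((1 + x) ^ n - 1 - n * x) + n * (s * (D * t) ^ 2) := by simp only [x]; ring
          rw [Real.norm_eq_abs, e2]
          calc _ ≤ |(1 + x) ^ n - 1 - n * x| + |n * (s * (D * t) ^ 2)| := abs_add_le _ _
            _ ≤ C * x ^ 2 + n * (1 * (D * t) ^ 2) := by
              rw [abs_mul, abs_mul, abs_of_pos hn, abs_of_nonneg (sq_nonneg (D * t))]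
              gcongr
            _ ≤ C * (2 * D * t) ^ 2 + n * (1 * (D * t) ^ 2) := by gcongr
            _ = M * t ^ 2 := by simp only [M]; ring
      _ = _ := by ring
  refine ⟨σ.real univ * M / n, 1 / (2 * D), by positivity, fun t ht htδ => ?_⟩
  have htD : t * D < 1 / 2 := by
    rw [lt_div_iff₀ (by positivity)] at htδ
    linarith
  set ε := t⁻¹
  have hε : 0 < ε := inv_pos.2 ht
  have htε : t * ε = 1 := mul_inv_cancel₀ ht.ne'
  have hεD : 2 * D < ε := by nlinarith
  have hball : ε • closedBall (0 : E) 1 = closedBall 0 ε := smul_unitClosedBall_of_nonneg hε.le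
  have hpos : ∀ s : ℝ, |s| ≤ 1 → ∀ u, 0 < h u + ε + s * (D ^ 2 * t) := by
    intro s hs u
    have h1 := (abs_le.1 (hhD u)).1
    have h2 := (abs_le.1 hs).1
    have h3 : D ^ 2 * t ≤ D := by nlinarith
    have h4 : -1 * (D ^ 2 * t) ≤ s * (D ^ 2 * t) := by gcongr
    linarith
  have hvol : ∀ s : ℝ, |s| ≤ 1 → (volume : Measure E).real
      (puncturedStar fun u => h u + ε + s * (D ^ 2 * t))
      = (∫ u, (h u + ε + s * (D ^ 2 * t)) ^ n ∂σ) / n := fun s hs =>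
    volume_puncturedStar (by fun_prop) (hpos s hs)
  have hcomp : IsCompact (K + ε • closedBall (0 : E) 1) :=
    hK.add ((isCompact_closedBall 0 1).smul ε)
  -- The point `y` of `K` extremal in direction `u` is already within `ε` of `x`: one has `‖x - y‖²
  -- = (‖x‖ - h u)² - (h u)² + ‖y‖²`, and the correction `D² t` absorbs `‖y‖²`.
  have hlow : puncturedStar (fun u => h u + ε + (-1) * (D ^ 2 * t)) ⊆
      K + ε • closedBall (0 : E) 1 := by
    intro x hx
    obtain ⟨u, hxu, hx0, hxg⟩ := mem_puncturedStar.1 hx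
    obtain ⟨y, hy, hyu⟩ := exists_inner_eq_supportFun hK hne (u : E)
    rw [hball]
    refine ⟨y, hy, x - y, ?_, by simp⟩
    rw [mem_closedBall_zero_iff]
    refine le_of_sq_le_sq ?_ hε.le
    have e1 : ⟪x, y⟫ = ‖x‖ * h u := by
      nth_rw 1 [hxu]
      rw [real_inner_smul_left, real_inner_comm, hyu]
    rw [norm_sub_sq_real, e1]
    have h1 := abs_le.1 (hhD u)
    have h2 : ‖y‖ ^ 2 ≤ D ^ 2 := by gcongr; exact hD y hy
    have h3 : D ^ 2 * t ≤ D / 2 := by nlinarith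
    have h4 : (‖x‖ - h u) ^ 2 ≤ (ε - D ^ 2 * t) ^ 2 := by
      refine sq_le_sq' ?_ ?_ <;> linarith
    have h5 : (ε - D ^ 2 * t) ^ 2 ≤ ε ^ 2 - D ^ 2 := by
      have : (ε - D ^ 2 * t) ^ 2 = ε ^ 2 - 2 * D ^ 2 * (t * ε) + D ^ 2 * (t * D) ^ 2 := by ring
      rw [this, htε]
      nlinarith [sq_nonneg D, mul_pos ht hD0, mul_nonneg (sq_nonneg D)
        (by nlinarith [mul_pos ht hD0] : 0 ≤ 1 - (t * D) ^ 2)]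
    nlinarith [sq_nonneg (h u)]
  have hup : K + ε • closedBall (0 : E) 1 ⊆
      insert 0 (puncturedStar (fun u => h u + ε + 1 * (D ^ 2 * t))) := by
    rw [hball]
    rintro x ⟨k, hk, b, hb, rfl⟩
    rw [mem_closedBall_zero_iff] at hb
    rcases eq_or_ne (k + b) 0 with h0 | h0
    · exact Or.inl h0
    right
    simp only
    set x := k + b
    have hx0 : 0 < ‖x‖ := norm_pos_iff.2 h0
    let u : sphere (0 : E) 1 := ⟨‖x‖⁻¹ • x, by simp [norm_smul, hx0.ne']⟩
    have hu : ‖(u : E)‖ = 1 := hunorm u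
    refine mem_puncturedStar.2 ⟨u, by simp [u, smul_smul, hx0.ne'], hx0, ?_⟩
    have e : ‖x‖ = ⟪k, (u : E)⟫ + ⟪b, (u : E)⟫ := by
      rw [← inner_add_left]
      change ‖x‖ = ⟪x, ‖x‖⁻¹ • x⟫
      rw [real_inner_smul_right, real_inner_self_eq_norm_sq]
      field_simp
    have h1 : ⟪k, (u : E)⟫ ≤ h u := inner_le_supportFun hK _ hk
    have h2 : ⟪b, (u : E)⟫ ≤ ε := (real_inner_le_norm _ _).trans (by rw [hu, mul_one]; exact hb)
    have : 0 < D ^ 2 * t := by positivity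
    linarith
  -- Infinite volume would have real value `0`, against the positive integral in `hvol`.
  have hfinite : (volume : Measure E) (puncturedStar fun u => h u + ε + 1 * (D ^ 2 * t)) ≠ ⊤ := by
    intro htop
    have h1 := hvol 1 (by simp)
    rw [measureReal_def, htop, ENNReal.toReal_top] at h1
    have h2 := key t ht htD.le 1 (by simp)
    have h3 : 0 < (∫ u, (h u + ε + 1 * (D ^ 2 * t)) ^ n ∂σ) := by
      have hc : Continuous fun u => (h u + ε + 1 * (D ^ 2 * t)) ^ n := by fun_prop
      obtain ⟨x, hx⟩ := exists_ne (0 : E)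
      let u0 : sphere (0 : E) 1 := ⟨‖x‖⁻¹ • x, by simp [norm_smul, hx]⟩
      exact hc.integral_pos_of_hasCompactSupport_nonneg_nonzero (HasCompactSupport.of_compactSpace _)
        (fun u => (pow_pos (hpos 1 (by simp) u) n).le) (x := u0)
        (pow_pos (hpos 1 (by simp) u0) n).ne'
    have := div_pos h3 hn
    linarith
  have hA := key t ht htD.le (-1) (by simp)
  have hB := key t ht htD.le 1 (by simp)
  have hA' : (∫ u, (h u + ε + (-1) * (D ^ 2 * t)) ^ n ∂σ) / n
      ≤ (volume : Measure E).real (K + ε • closedBall (0 : E) 1) := by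
    rw [← hvol (-1) (by simp)]
    exact measureReal_mono hlow hcomp.measure_lt_top.ne
  have hB' : (volume : Measure E).real (K + ε • closedBall (0 : E) 1)
      ≤ (∫ u, (h u + ε + 1 * (D ^ 2 * t)) ^ n ∂σ) / n := by
    rw [← hvol 1 (by simp)]
    refine (measureReal_mono hup ?_).trans ?_
    · rw [insert_eq]
      exact (measure_union_lt_top (by simp) (lt_top_iff_ne_top.2 hfinite)).ne
    · rw [insert_eq]
      exact (measureReal_union_le _ _).trans (by simp [measureReal_def])
  rw [mul_div_assoc] at hA hB
  have hA2 := mul_le_mul_of_nonneg_left hA' (pow_nonneg ht.le n)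
  have hB2 := mul_le_mul_of_nonneg_left hB' (pow_nonneg ht.le n)
  rw [abs_le] at hA hB ⊢
  constructor <;> linarith [hA.1, hB.2]

/-- The next-to-leading coefficient of the Steiner polynomial is the integral of the support
function over the unit sphere. -/
theorem steiner_coeff_eq_integral_supportFun {K : Set E} (hne : K.Nonempty) (hK : IsCompact K)
    {a : ℕ → ℝ} (ha : ∀ t : ℝ, 0 < t →
      (volume : Measure E).real (K + t • closedBall (0 : E) 1) =
        ∑ j ∈ Finset.range (Module.finrank ℝ E + 1), a j * t ^ (Module.finrank ℝ E - j)) :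
    a 1 = ∫ u, supportFun K u ∂(volume : Measure E).toSphere := by
  set n := Module.finrank ℝ E with hndef
  have hn : 0 < n := Module.finrank_pos
  obtain ⟨C, δ, hδ, h⟩ := exists_abs_volume_parallel_sub_le hne hK
  rw [← hndef] at h
  set α := (volume : Measure E).toSphere.real univ / n
  set β := ∫ u, supportFun K u ∂(volume : Measure E).toSphere
  -- Substituting `t⁻¹` and multiplying by `t ^ n` reverses the Steiner polynomial, so `a 1` becomes
  -- a linear coefficient.
  let P : ℝ[X] := (∑ j ∈ Finset.range (n + 1), Polynomial.C (a j) * X ^ j)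
    - (Polynomial.C α + Polynomial.C β * X)
  have hP : P.coeff 1 = 0 := by
    refine coeff_one_eq_zero_of_abs_le (C := C) hδ fun t ht0 ht1 => ?_
    have e : P.eval t = t ^ n * (volume : Measure E).real (K + t⁻¹ • closedBall (0 : E) 1)
        - (α + β * t) := by
      rw [ha _ (inv_pos.2 ht0), Finset.mul_sum]
      simp only [P, eval_sub, eval_finsetSum, eval_add, eval_mul, eval_C, eval_pow, eval_X]
      congr 1
      refine Finset.sum_congr rfl fun j hj => ?_
      have hj : j ≤ n := by simpa [Nat.lt_succ_iff] using hj
      obtain ⟨k, hk⟩ := Nat.exists_eq_add_of_le hj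
      rw [hk, Nat.add_sub_cancel_left, pow_add, inv_pow]
      field_simp
    rw [e]
    exact h t ht0 ht1
  have hc : P.coeff 1 = a 1 - β := by
    have h1 : (1 : ℕ) ∈ Finset.range (n + 1) := by simp; omega
    simp only [P, coeff_sub, finsetSum_coeff, coeff_C_mul, coeff_X_pow, coeff_add, coeff_C,
      coeff_X_one]
    simp [Finset.sum_ite_eq, hn]
  linarith

end Parallel

lemma unitBallVolume_pos (m : ℕ) : 0 < unitBallVolume m := by
  rw [unitBallVolume, measureReal_def]
  exact ENNReal.toReal_pos (measure_closedBall_pos _ _ one_pos).ne' measure_closedBall_lt_top.ne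

/-- The first intrinsic volume is proportional to the mean of the support function. -/
theorem intrinsicVolume_one_eq {n : ℕ} (hn : 0 < n) {K : Set (EuclideanSpace ℝ (Fin n))}
    (hne : K.Nonempty) (hK : IsCompact K) (hconv : Convex ℝ K) :
    unitBallVolume (n - 1) * intrinsicVolume 1 K = ∫ u, supportFun K u
      ∂(volume : Measure (EuclideanSpace ℝ (Fin n))).toSphere := by
  have : Nonempty (Fin n) := ⟨⟨0, hn⟩⟩
  -- `Classical.epsilon` is meaningful only once some sequence of Steiner coefficients is known to
  -- exist.
  have hex : ∃ V, IsSteinerCoefficients K V := by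
    obtain ⟨c, hc⟩ := exists_steiner_polynomial hne hK hconv
    rw [finrank_euclideanSpace_fin] at hc
    refine ⟨fun j => if n < j then 0 else c (n - j) / unitBallVolume (n - j), fun t ht => ?_,
      fun j hj => if_pos hj⟩
    rw [hc t ht, ← Finset.sum_range_reflect]
    refine Finset.sum_congr rfl fun j hj => ?_
    have hj : ¬ n < j := by simpa [Nat.lt_succ_iff] using hj
    simp only [if_neg hj, Nat.add_sub_cancel]
    rw [mul_div_cancel₀ _ (unitBallVolume_pos _).ne']
  have hV := (Classical.epsilon_spec hex).1
  refine steiner_coeff_eq_integral_supportFun (a := fun j => unitBallVolume (n - j) *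
    intrinsicVolume j K) hne hK fun t ht => ?_
  rw [finrank_euclideanSpace_fin]
  exact hV t ht

end ReverseInradius

end MeanWidth

/-! ### Blaschke's rolling theorem. -/

section RollingBall

open Metric Set
open scoped Pointwise Topology RealInnerProductSpace

namespace ReverseInradius

variable {E : Type*} [NormedAddCommGroup E] [InnerProductSpace ℝ E]

/-- At every boundary point, `K` is locally contained in a ball of radius `R` whose sphere passes
through this point. -/
def LocallySupportedByBalls (R : ℝ) (K : Set E) : Prop :=
  ∀ p ∈ frontier K, ∃ U ∈ 𝓝 p, ∃ c : E, p ∈ sphere c R ∧ U ∩ K ⊆ closedBall c R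

/-- A circular arc that touches a sphere of radius `R` from inside has radius at most `R`. -/
lemma norm_le_of_symmetric_arc {q A B : E} {R θ : ℝ} (hAB : ⟪A, B⟫ = 0) (hnorm : ‖A‖ = ‖B‖)
    (hcos : Real.cos θ < 1) (hR : 0 ≤ R) (h0 : ‖q + A‖ = R)
    (h1 : ‖q + (Real.cos θ • A + Real.sin θ • B)‖ ≤ R)
    (h2 : ‖q + (Real.cos θ • A - Real.sin θ • B)‖ ≤ R) : ‖A‖ ≤ R := by
  have e0 : ‖q + A‖ ^ 2 = ‖q‖ ^ 2 + 2 * ⟪q, A⟫ + ‖A‖ ^ 2 := norm_add_sq_real q A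
  have hcs := Real.cos_sq_add_sin_sq θ
  have e1 : ‖q + (Real.cos θ • A + Real.sin θ • B)‖ ^ 2 + ‖q + (Real.cos θ • A - Real.sin θ • B)‖ ^ 2
      = 2 * (‖q‖ ^ 2 + 2 * Real.cos θ * ⟪q, A⟫ + ‖A‖ ^ 2) := by
    rw [norm_add_sq_real, norm_add_sq_real, norm_add_sq_real, norm_sub_sq_real]
    simp only [inner_add_right, inner_sub_right, real_inner_smul_left, real_inner_smul_right, hAB,
      norm_smul, mul_pow, Real.norm_eq_abs, sq_abs, ← hnorm]
    linear_combination 2 * ‖A‖ ^ 2 * hcs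
  have h1' : ‖q + (Real.cos θ • A + Real.sin θ • B)‖ ^ 2 ≤ R ^ 2 := by gcongr
  have h2' : ‖q + (Real.cos θ • A - Real.sin θ • B)‖ ^ 2 ≤ R ^ 2 := by gcongr
  rw [h0] at e0
  have h3 : 0 ≤ ⟪q, A⟫ := by
    by_contra! hlt
    nlinarith
  have : ‖A‖ ^ 2 ≤ R ^ 2 := by nlinarith [sq_nonneg ‖q‖]
  exact le_of_sq_le_sq this hR

/-- The circular segment over a chord in the interior, bounded by an arc of radius greater than
`R`, lies in the interior. -/
lemma circularSegment_subset_interior {K : Set E} (hK : IsClosed K) (hconv : Convex ℝ K) {R : ℝ}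
    (hR : 0 < R) (hloc : LocallySupportedByBalls R K) {m e w : E} (he : ‖e‖ = 1) (hw : ‖w‖ = 1)
    (hew : ⟪e, w⟫ = 0) {a h : ℝ} (ha : 0 < a) (hh : 0 < h) (hahR : R ^ 2 < h ^ 2 + a ^ 2)
    (hp : m + a • e ∈ interior K) (hq : m - a • e ∈ interior K) {α β : ℝ} (hβ : 0 ≤ β)
    (hαβ : α ^ 2 + β ^ 2 + 2 * h * β ≤ a ^ 2) : m + α • e + β • w ∈ interior K := by
  by_contra hnot
  set F : ℝ × ℝ → E := fun z => m + z.1 • e + z.2 • w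
  have hF : Continuous F := by fun_prop
  set N : Set (ℝ × ℝ) := {z | 0 ≤ z.2 ∧ z.1 ^ 2 + z.2 ^ 2 + 2 * h * z.2 ≤ a ^ 2} ∩
    F ⁻¹' (interior K)ᶜ
  have hNclosed : IsClosed N := by
    refine IsClosed.inter ?_ (isOpen_interior.isClosed_compl.preimage hF)
    exact (isClosed_le continuous_const continuous_snd).inter (isClosed_le
      (by fun_prop : Continuous fun z : ℝ × ℝ => z.1 ^ 2 + z.2 ^ 2 + 2 * h * z.2) continuous_const)
  have hNcomp : IsCompact N := by
    refine (isCompact_Icc.prod isCompact_Icc : IsCompact (Icc (-a) a ×ˢ Icc (-a) a)).of_isClosed_subset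
      hNclosed ?_
    rintro ⟨x, y⟩ ⟨⟨h1, h2⟩, -⟩
    simp only at h1 h2
    have : 0 ≤ 2 * h * y := by positivity
    exact ⟨abs_le.1 (abs_le_of_sq_le_sq (by nlinarith) ha.le),
      abs_le.1 (abs_le_of_sq_le_sq (by nlinarith) ha.le)⟩
  have hNpos : ∀ z ∈ N, 0 < z.2 := by
    rintro ⟨x, y⟩ ⟨⟨h1, h2⟩, h3⟩
    simp only at h1 h2 ⊢
    rcases h1.eq_or_lt with h | h
    · exfalso
      subst h
      apply h3
      have hx : |x| ≤ a := abs_le_of_sq_le_sq (by simpa using h2) ha.le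
      have hx := abs_le.1 hx
      have hint : Convex ℝ (interior K) := hconv.interior
      have := hint hp hq (a := (a + x) / (2 * a)) (b := (a - x) / (2 * a))
        (div_nonneg (by linarith) (by positivity)) (div_nonneg (by linarith) (by positivity))
        (by field_simp; ring)
      convert this using 1
      simp only [F, zero_smul, add_zero]
      match_scalars <;> field_simp <;> ring
    · exact h
  -- The circle through both chord ends and `z` has centre `(0, -H z)`, so a larger `H` means a
  -- flatter arc over the chord. A maximiser on `N` gives the first arc, swept up from the chord,
  -- that meets the complement of the interior.
  set H : ℝ × ℝ → ℝ := fun z => (a ^ 2 - z.1 ^ 2 - z.2 ^ 2) / (2 * z.2)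
  have hH : ContinuousOn H N := by
    refine ContinuousOn.div (by fun_prop) (by fun_prop) fun z hz => ?_
    have := hNpos z hz
    positivity
  obtain ⟨z, hzN, hzmax⟩ := hNcomp.exists_isMaxOn (⟨(α, β), ⟨hβ, hαβ⟩, hnot⟩ : N.Nonempty) hH
  obtain ⟨α₀, β₀⟩ := z
  have hβ₀ : 0 < β₀ := hNpos _ hzN
  set h₀ := H (α₀, β₀) with hh₀
  have hz : α₀ ^ 2 + β₀ ^ 2 + 2 * h₀ * β₀ = a ^ 2 := by
    rw [hh₀]
    simp only [H]
    field_simp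
    ring
  have hle : h ≤ h₀ := by
    have := hzN.1.2
    simp only at this
    by_contra! hlt
    nlinarith
  -- Points just below the extremal arc have larger `H`, hence lie in `K`; closedness gives the arc
  -- itself.
  have harc : ∀ α β : ℝ, 0 < β → α ^ 2 + β ^ 2 + 2 * h₀ * β = a ^ 2 → F (α, β) ∈ K := by
    intro α β hβ hαβ
    have hs : ∀ s ∈ Ioo (0 : ℝ) 1, F (α, s * β) ∈ K := by
      intro s hs
      have hsβ : 0 < s * β := mul_pos hs.1 hβ
      have hsβ' : s * β < β := by nlinarith [hs.2]
      by_contra hn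
      have hlt : α ^ 2 + (s * β) ^ 2 + 2 * h₀ * (s * β) < a ^ 2 := by
        rw [← hαβ]
        have : (s * β) ^ 2 < β ^ 2 := by gcongr
        have : 2 * h₀ * (s * β) ≤ 2 * h₀ * β := by
          have : 0 ≤ 2 * h₀ := by linarith
          gcongr
        linarith
      have hmem : (α, s * β) ∈ N := by
        refine ⟨⟨hsβ.le, ?_⟩, fun hi => hn (interior_subset hi)⟩
        simp only
        have : 2 * h * (s * β) ≤ 2 * h₀ * (s * β) := by gcongr
        linarith
      have hmax : H (α, s * β) ≤ h₀ := hzmax hmem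
      simp only [H] at hmax
      rw [div_le_iff₀ (by positivity)] at hmax
      linarith
    have ht : Filter.Tendsto (fun s : ℝ => F (α, s * β)) (𝓝[<] 1) (𝓝 (F (α, 1 * β))) := by
      have : Continuous fun s : ℝ => F (α, s * β) := by fun_prop
      exact (this.tendsto 1).mono_left nhdsWithin_le_nhds
    rw [one_mul] at ht
    refine hK.mem_of_tendsto ht ?_
    filter_upwards [Ioo_mem_nhdsLT (zero_lt_one (α := ℝ))] with s hs' using hs s hs'
  have hfr : F (α₀, β₀) ∈ frontier K := by
    rw [hK.frontier_eq]
    exact ⟨harc _ _ hβ₀ hz, hzN.2⟩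
  obtain ⟨U, hU, c, hc, hUK⟩ := hloc _ hfr
  set A : E := α₀ • e + (β₀ + h₀) • w
  set B : E := (-(β₀ + h₀)) • e + α₀ • w
  have hwe : ⟪w, e⟫ = 0 := by rw [real_inner_comm, hew]
  have hee : ⟪e, e⟫ = 1 := by rw [real_inner_self_eq_norm_sq, he, one_pow]
  have hww : ⟪w, w⟫ = 1 := by rw [real_inner_self_eq_norm_sq, hw, one_pow]
  have hAB : ⟪A, B⟫ = 0 := by
    simp only [A, B, inner_add_left, inner_add_right, real_inner_smul_left, real_inner_smul_right,
      hew, hwe, hee, hww]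
    ring
  have hA : ‖A‖ ^ 2 = a ^ 2 + h₀ ^ 2 := by
    rw [← hz, ← real_inner_self_eq_norm_sq]
    simp only [A, inner_add_left, inner_add_right, real_inner_smul_left, real_inner_smul_right,
      hew, hwe, hee, hww]
    ring
  have hB : ‖B‖ ^ 2 = a ^ 2 + h₀ ^ 2 := by
    rw [← hz, ← real_inner_self_eq_norm_sq]
    simp only [B, inner_add_left, inner_add_right, real_inner_smul_left, real_inner_smul_right,
      hew, hwe, hee, hww]
    ring
  have hnorm : ‖A‖ = ‖B‖ := by
    rw [← sq_eq_sq₀ (norm_nonneg _) (norm_nonneg _), hA, hB]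
  -- Rotating by `±θ` about the centre of the extremal arc gives two nearby points of the arc on
  -- either side of the touching point. The supporting ball then bounds the arc's radius by `R`,
  -- although that radius exceeds `R`.
  set x : ℝ → ℝ := fun θ => Real.cos θ * α₀ - Real.sin θ * (β₀ + h₀)
  set y : ℝ → ℝ := fun θ => Real.cos θ * (β₀ + h₀) + Real.sin θ * α₀ - h₀
  have hxy : ∀ θ, x θ ^ 2 + y θ ^ 2 + 2 * h₀ * y θ = a ^ 2 := fun θ => by
    simp only [x, y]
    linear_combination hz + (α₀ ^ 2 + (β₀ + h₀) ^ 2) * Real.cos_sq_add_sin_sq θ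
  have hFxy : ∀ θ, F (x θ, y θ) = (m - h₀ • w) + (Real.cos θ • A + Real.sin θ • B) := fun θ => by
    simp only [F, x, y, A, B]
    match_scalars <;> ring
  have hev : ∀ᶠ θ in 𝓝 (0 : ℝ), 0 < y θ ∧ F (x θ, y θ) ∈ U := by
    have hx0 : x 0 = α₀ := by simp [x]
    have hy0 : y 0 = β₀ := by simp [y]
    have hyc : Continuous y := by fun_prop
    have hFc : Continuous fun θ => F (x θ, y θ) := by fun_prop
    refine (hyc.tendsto 0 |>.eventually (lt_mem_nhds (by rwa [hy0]))).and (hFc.tendsto 0 ?_)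
    rwa [hx0, hy0]
  have hev' : ∀ᶠ θ in 𝓝 (0 : ℝ), 0 < y (-θ) ∧ F (x (-θ), y (-θ)) ∈ U := by
    have : Filter.Tendsto (fun θ : ℝ => -θ) (𝓝 0) (𝓝 0) := by simpa using (continuous_neg.tendsto (0 : ℝ))
    exact this.eventually hev
  obtain ⟨θ, ⟨⟨hy1, hU1⟩, hy2, hU2⟩, hθ0, hθ1⟩ :=
    (((hev.and hev').filter_mono nhdsWithin_le_nhds).and (Ioo_mem_nhdsGT one_pos)).exists
  have hcos : Real.cos θ < 1 := by
    rw [← Real.cos_zero]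
    exact Real.cos_lt_cos_of_nonneg_of_le_pi le_rfl (by linarith [Real.pi_gt_three]) hθ0
  have hb1 := hUK ⟨hU1, harc _ _ hy1 (hxy θ)⟩
  have hb2 := hUK ⟨hU2, harc _ _ hy2 (hxy (-θ))⟩
  rw [mem_closedBall, dist_eq_norm, hFxy] at hb1 hb2
  rw [mem_sphere, dist_eq_norm] at hc
  have hAR := norm_le_of_symmetric_arc (q := m - h₀ • w - c) hAB hnorm hcos hR.le
    (by rw [← hc]; congr 1; simp only [F, A]; module)
    (by rw [show m - h₀ • w - c + (Real.cos θ • A + Real.sin θ • B)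
          = m - h₀ • w + (Real.cos θ • A + Real.sin θ • B) - c by abel]; exact hb1)
    (by
      rw [Real.cos_neg, Real.sin_neg] at hb2
      rw [show m - h₀ • w - c + (Real.cos θ • A - Real.sin θ • B)
          = m - h₀ • w + (Real.cos θ • A + -Real.sin θ • B) - c by module]
      exact hb2)
  have : ‖A‖ ^ 2 ≤ R ^ 2 := by gcongr
  have : h ^ 2 ≤ h₀ ^ 2 := by gcongr
  linarith

/-- By convexity the segment from `p` to `y` starts inside the ball, so it cannot leave `p` on the
outer side of the tangent hyperplane. -/
lemma inner_sub_nonpos_of_locally_subset_closedBall {K : Set E} (hconv : Convex ℝ K) {R : ℝ}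
    {p c : E} {U : Set E} (hU : U ∈ 𝓝 p) (hp : p ∈ K) (hpc : p ∈ sphere c R)
    (hUK : U ∩ K ⊆ closedBall c R) {y : E} (hy : y ∈ K) : ⟪y - p, p - c⟫ ≤ 0 := by
  rw [mem_sphere, dist_eq_norm] at hpc
  have hc : Continuous fun s : ℝ => p + s • (y - p) := by fun_prop
  have hev : ∀ᶠ s in 𝓝 (0 : ℝ), p + s • (y - p) ∈ U := hc.tendsto 0 (by simpa using hU)
  by_contra! hpos
  obtain ⟨s, hsU, hs0, hs1⟩ :=
    ((hev.filter_mono nhdsWithin_le_nhds).and (Ioo_mem_nhdsGT one_pos)).exists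
  have hsK : p + s • (y - p) ∈ K := by
    have := hconv hp hy (sub_nonneg.2 hs1.le) hs0.le (by ring)
    convert this using 1
    module
  have h1 := hUK ⟨hsU, hsK⟩
  rw [mem_closedBall, dist_eq_norm, show p + s • (y - p) - c = (p - c) + s • (y - p) by abel] at h1
  have h2 := norm_add_sq_real (p - c) (s • (y - p))
  rw [real_inner_smul_right, real_inner_comm, hpc] at h2
  have h3 : ‖(p - c) + s • (y - p)‖ ^ 2 ≤ R ^ 2 := by gcongr
  have h4 := mul_pos hs0 hpos
  nlinarith [sq_nonneg ‖s • (y - p)‖]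

/-- Parameters for the rolling theorem: an arc of radius above `R` over a chord of length `ρ`, and a
slope `k` that stays below this arc to first order but crosses the tangent hyperplane. The gap
exists because `2 * σ < ρ ^ 2`; `h ^ 2` is taken slightly above `max 0 (R ^ 2 - (ρ / 2) ^ 2)`. -/
lemma exists_height_and_slope {R ρ γ σ : ℝ} (hR : 0 < R) (hρ : 0 < ρ) (hγ0 : 0 < γ) (hσ0 : 0 ≤ σ)
    (hσρ : 2 * σ < ρ ^ 2) (hγsq' : ρ ^ 2 * γ ^ 2 = ρ ^ 2 * R ^ 2 - σ ^ 2) :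
    ∃ h k : ℝ, 0 < h ∧ 0 < k ∧ R ^ 2 < h ^ 2 + (ρ / 2) ^ 2 ∧ σ < k * γ ^ 2 ∧
      2 * h * k * γ < ρ ^ 2 := by
  obtain ⟨h, hh0, hhR, hhσ⟩ : ∃ h > 0, R ^ 2 < h ^ 2 + (ρ / 2) ^ 2 ∧ 2 * h * σ < ρ ^ 2 * γ := by
    set A := max 0 (R ^ 2 - (ρ / 2) ^ 2)
    have hA0 : 0 ≤ A := le_max_left _ _
    have hA : 4 * σ ^ 2 * A < ρ ^ 4 * γ ^ 2 := by
      rw [show ρ ^ 4 * γ ^ 2 = ρ ^ 2 * (ρ ^ 2 * γ ^ 2) by ring]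
      rcases max_choice 0 (R ^ 2 - (ρ / 2) ^ 2) with h | h
      · rw [show A = 0 from h, mul_zero]
        positivity
      · rw [show A = _ from h, hγsq']
        have : (2 * σ) ^ 2 < (ρ ^ 2) ^ 2 := by gcongr
        nlinarith [mul_pos (sub_pos.2 this) (pow_pos hR 2)]
    set δ := (ρ ^ 4 * γ ^ 2 - 4 * σ ^ 2 * A) / (4 * σ ^ 2 + 1)
    have hδ : 0 < δ := div_pos (by linarith) (by positivity)
    have hδe : δ * (4 * σ ^ 2 + 1) = ρ ^ 4 * γ ^ 2 - 4 * σ ^ 2 * A := div_mul_cancel₀ _ (by positivity)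
    have hsq : Real.sqrt (A + δ) ^ 2 = A + δ := Real.sq_sqrt (by positivity)
    refine ⟨Real.sqrt (A + δ), Real.sqrt_pos.2 (by positivity), ?_, ?_⟩
    · rw [hsq]
      linarith [le_max_right 0 (R ^ 2 - (ρ / 2) ^ 2)]
    · refine lt_of_pow_lt_pow_left₀ 2 (by positivity) ?_
      rw [mul_pow, mul_pow, hsq, mul_pow]
      nlinarith
  obtain ⟨k, hk1, hk2⟩ : ∃ k, σ / γ ^ 2 < k ∧ k < ρ ^ 2 / (2 * h * γ) := by
    refine exists_between ?_
    rw [div_lt_div_iff₀ (by positivity) (by positivity)]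
    nlinarith
  have hk0 : 0 < k := lt_of_le_of_lt (by positivity) hk1
  rw [div_lt_iff₀ (by positivity)] at hk1
  rw [lt_div_iff₀ (by positivity)] at hk2
  exact ⟨h, k, hh0, hk0, hhR, hk1, by linarith⟩

/-- A small shift orthogonal to `g` destroys parallelism with `g`, and the conditions on the point
are open. -/
lemma exists_not_mem_closedBall_not_parallel {K : Set E} {R : ℝ} (hR : 0 < R)
    (hdim : ∀ u : E, ∃ w : E, w ≠ 0 ∧ ⟪u, w⟫ = 0) {p c g x₀ : E} (hg : ‖g‖ = R)
    (hx₀ : x₀ ∈ interior K) (hx₀c : x₀ ∉ closedBall c R) :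
    ∃ x ∈ interior K, x ∉ closedBall c R ∧ ⟪x - p, g⟫ ^ 2 < ‖x - p‖ ^ 2 * R ^ 2 := by
  obtain ⟨w, hw, hgw⟩ := hdim g
  have hwg : ⟪w, g⟫ = 0 := by rw [real_inner_comm, hgw]
  have hgg : ⟪g, g⟫ = R ^ 2 := by rw [real_inner_self_eq_norm_sq, hg]
  by_cases hpar : x₀ - p = (⟪x₀ - p, g⟫ / R ^ 2) • g
  · have hopen : IsOpen (interior K ∩ (closedBall c R)ᶜ) :=
      isOpen_interior.inter isClosed_closedBall.isOpen_compl
    have hcont : Continuous fun s : ℝ => x₀ + s • w := by fun_prop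
    have hev : ∀ᶠ s in 𝓝 (0 : ℝ), x₀ + s • w ∈ interior K ∩ (closedBall c R)ᶜ :=
      hcont.tendsto 0 (by simpa using hopen.mem_nhds ⟨hx₀, hx₀c⟩)
    obtain ⟨s, ⟨hs1, hs2⟩, hs0⟩ :=
      ((hev.filter_mono nhdsWithin_le_nhds).and (self_mem_nhdsWithin (s := Ioi (0 : ℝ)))).exists
    refine ⟨x₀ + s • w, hs1, hs2, ?_⟩
    rw [show x₀ + s • w - p = (x₀ - p) + s • w by abel, hpar]
    set k := ⟪x₀ - p, g⟫ / R ^ 2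
    have hsw : 0 < ‖s • w‖ := norm_pos_iff.2 (smul_ne_zero (ne_of_gt hs0) hw)
    rw [norm_add_sq_real, inner_add_left, real_inner_smul_left, real_inner_smul_left,
      real_inner_smul_left, real_inner_smul_right, hgw, hwg, hgg, norm_smul k, mul_pow, hg,
      Real.norm_eq_abs, sq_abs]
    have : 0 < ‖s • w‖ ^ 2 * R ^ 2 := by positivity
    nlinarith
  · refine ⟨x₀, hx₀, hx₀c, ?_⟩
    have hpos : 0 < ‖x₀ - p - (⟪x₀ - p, g⟫ / R ^ 2) • g‖ ^ 2 := by
      have := norm_pos_iff.2 (sub_ne_zero.2 hpar)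
      positivity
    rw [norm_sub_sq_real, real_inner_smul_right, norm_smul, mul_pow, hg, Real.norm_eq_abs,
      sq_abs] at hpos
    field_simp at hpos
    nlinarith

/-- Blaschke's rolling theorem: local containment in balls of radius `R` at all boundary points
implies global containment. -/
theorem subset_closedBall_of_locallySupportedByBalls {K : Set E} (hK : IsClosed K)
    (hconv : Convex ℝ K) (hint : (interior K).Nonempty) {R : ℝ} (hR : 0 < R)
    (hloc : LocallySupportedByBalls R K) (hdim : ∀ u : E, ∃ w : E, w ≠ 0 ∧ ⟪u, w⟫ = 0)
    {p c : E} (hp : p ∈ frontier K) {U : Set E} (hU : U ∈ 𝓝 p) (hpc : p ∈ sphere c R)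
    (hUK : U ∩ K ⊆ closedBall c R) : K ⊆ closedBall c R := by
  have hpK : p ∈ K := hK.frontier_subset hp
  have hhalf : ∀ y ∈ K, ⟪y - p, p - c⟫ ≤ 0 := fun y hy =>
    inner_sub_nonpos_of_locally_subset_closedBall hconv hU hpK hpc hUK hy
  have hg : ‖p - c‖ = R := by rwa [mem_sphere, dist_eq_norm] at hpc
  set g := p - c
  suffices hsuff : ∀ x ∈ interior K, x ∈ closedBall c R by
    rw [← hK.closure_eq, ← hconv.closure_interior_eq_closure_of_nonempty_interior hint]
    exact closure_minimal hsuff isClosed_closedBall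
  intro x₀ hx₀
  by_contra hx₀c
  obtain ⟨x, hx, hxc, hγ⟩ := exists_not_mem_closedBall_not_parallel hR hdim (g := p - c) (p := p)
    (by rwa [mem_sphere, dist_eq_norm] at hpc) hx₀ hx₀c
  set d := x - p
  set ρ := ‖d‖
  have hdg := hhalf x (interior_subset hx)
  obtain ⟨σ, hσ⟩ : ∃ σ, σ = -⟪d, g⟫ := ⟨_, rfl⟩
  have hσ0 : 0 ≤ σ := by rw [hσ]; linarith
  have hdg' : ⟪d, g⟫ = -σ := by rw [hσ, neg_neg]
  have hgd : ⟪g, d⟫ = -σ := by rw [real_inner_comm, hdg']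
  have hγ' : σ ^ 2 < ρ ^ 2 * R ^ 2 := by
    have : ⟪d, g⟫ ^ 2 < ρ ^ 2 * R ^ 2 := hγ
    rw [hdg'] at this
    linarith [neg_sq σ]
  have hρ : 0 < ρ := by
    rcases (norm_nonneg d).eq_or_lt with h | h
    · rw [show ρ = 0 from h.symm] at hγ'
      nlinarith [sq_nonneg σ]
    · exact h
  have hσρ : 2 * σ < ρ ^ 2 := by
    have h1 : R ^ 2 < ‖x - c‖ ^ 2 := by
      rw [mem_closedBall, dist_eq_norm, not_le] at hxc
      gcongr
    rw [show x - c = d + g by simp only [d, g]; abel, norm_add_sq_real, hdg', hg] at h1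
    linarith
  -- The component of the outer normal `g` orthogonal to the chord direction `d`.
  set f : E := g + (σ / ρ ^ 2) • d
  set γ := ‖f‖
  have hdd : ⟪d, d⟫ = ρ ^ 2 := real_inner_self_eq_norm_sq d
  have hdf : ⟪d, f⟫ = 0 := by
    simp only [f, inner_add_right, real_inner_smul_right, hdg', hdd]
    field_simp
    ring
  have hγsq : γ ^ 2 = R ^ 2 - σ ^ 2 / ρ ^ 2 := by
    have : γ ^ 2 = ⟪f, f⟫ := (real_inner_self_eq_norm_sq f).symm
    rw [this]
    simp only [f, inner_add_right, inner_add_left, real_inner_smul_left, real_inner_smul_right,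
      hdg', hgd, hdd, real_inner_self_eq_norm_sq g, hg]
    field_simp
    ring
  have hγsq' : ρ ^ 2 * γ ^ 2 = ρ ^ 2 * R ^ 2 - σ ^ 2 := by
    rw [hγsq]; field_simp
  have hγ0 : 0 < γ := by
    rcases (norm_nonneg f).eq_or_lt with h | h
    · rw [show γ = 0 from h.symm] at hγsq'
      nlinarith
    · exact h
  have hfg : ⟪f, g⟫ = γ ^ 2 := by
    rw [hγsq]
    simp only [f, inner_add_left, real_inner_smul_left, hdg', real_inner_self_eq_norm_sq g, hg]
    field_simp
    ring
  obtain ⟨h, k, hh0, hk0, hhR, hk1, hk2⟩ := exists_height_and_slope hR hρ hγ0 hσ0 hσρ hγsq'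
  have hev1 : ∀ᶠ s in 𝓝 (0 : ℝ),
      -ρ ^ 2 + 2 * h * k * γ + s * (2 * ρ ^ 2 + k ^ 2 * γ ^ 2) < 0 := by
    have : Continuous fun s : ℝ => -ρ ^ 2 + 2 * h * k * γ + s * (2 * ρ ^ 2 + k ^ 2 * γ ^ 2) := by
      fun_prop
    exact this.tendsto 0 |>.eventually (gt_mem_nhds (by linarith))
  have hev2 : ∀ᶠ s in 𝓝 (0 : ℝ), R ^ 2 < h ^ 2 + ((1 - s ^ 2) * ρ / 2) ^ 2 := by
    have : Continuous fun s : ℝ => h ^ 2 + ((1 - s ^ 2) * ρ / 2) ^ 2 := by fun_prop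
    exact this.tendsto 0 |>.eventually (lt_mem_nhds (by simpa using hhR))
  -- The chord runs from `p + s² d`, which is interior, to `x`; the shift is of second order in `s`.
  -- The segment lemma then puts `p + s d + s k f` in `K`, but its inner product with `g` relative
  -- to `p` is `s (k γ² - σ) > 0`.
  obtain ⟨s, ⟨hs1, hs2⟩, hs0, hs01⟩ :=
    (((hev1.and hev2).filter_mono nhdsWithin_le_nhds).and (Ioo_mem_nhdsGT one_pos)).exists
  have hs2' : 0 < 1 - s ^ 2 := by nlinarith
  have hp' : p + s ^ 2 • d ∈ interior K := by
    have := hconv.combo_closure_interior_mem_interior (subset_closure hpK) hx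
      (sub_nonneg.2 (by nlinarith : s ^ 2 ≤ 1)) (pow_pos hs0 2) (by ring)
    convert this using 1
    simp only [d]
    module
  have hmem := circularSegment_subset_interior hK hconv hR hloc
    (m := p + ((1 + s ^ 2) / 2) • d) (e := ρ⁻¹ • d) (w := γ⁻¹ • f) (a := (1 - s ^ 2) * ρ / 2) (h := h)
    (by rw [norm_smul, norm_inv, Real.norm_of_nonneg hρ.le, inv_mul_cancel₀ hρ.ne'])
    (by rw [norm_smul, norm_inv, Real.norm_of_nonneg hγ0.le, inv_mul_cancel₀ hγ0.ne'])
    (by rw [real_inner_smul_left, real_inner_smul_right, hdf]; simp)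
    (by positivity) hh0 hs2
    (by
      convert hx using 1
      rw [smul_smul, show (1 - s ^ 2) * ρ / 2 * ρ⁻¹ = (1 - s ^ 2) / 2 by field_simp]
      simp only [d]
      module)
    (by
      convert hp' using 1
      rw [smul_smul, show (1 - s ^ 2) * ρ / 2 * ρ⁻¹ = (1 - s ^ 2) / 2 by field_simp]
      module)
    (α := s * ρ - (1 + s ^ 2) * ρ / 2) (β := s * k * γ) (by positivity)
    (by nlinarith [mul_pos hs0 (neg_pos.2 hs1), pow_pos hs0 3, pow_pos hρ 2, mul_pos (pow_pos hs0 3) (pow_pos hρ 2)])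
  have h1 := hhalf _ (interior_subset hmem)
  have e : p + ((1 + s ^ 2) / 2) • d + (s * ρ - (1 + s ^ 2) * ρ / 2) • ρ⁻¹ • d
      + (s * k * γ) • γ⁻¹ • f - p = s • d + (s * k) • f := by
    rw [smul_smul, smul_smul, show (s * ρ - (1 + s ^ 2) * ρ / 2) * ρ⁻¹ = s - (1 + s ^ 2) / 2 by
      field_simp, show s * k * γ * γ⁻¹ = s * k by field_simp]
    module
  rw [e, inner_add_left, real_inner_smul_left, real_inner_smul_left, hfg, hdg'] at h1
  nlinarith [mul_pos hs0 (sub_pos.2 hk1)]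

end ReverseInradius

end RollingBall

/-! ### The inball and its contact points. -/

section Inball

open Metric Set
open scoped Pointwise Topology RealInnerProductSpace

namespace ReverseInradius

variable {E : Type*} [NormedAddCommGroup E] [InnerProductSpace ℝ E]

lemma exists_norm_eq_one_and_eq_smul [Nontrivial E] (x : E) : ∃ u : E, ‖u‖ = 1 ∧ x = ‖x‖ • u := by
  by_cases hx : x = 0
  · obtain ⟨u, hu⟩ := exists_norm_eq E zero_le_one
    exact ⟨u, hu, by simp [hx]⟩
  · have : ‖x‖ ≠ 0 := norm_ne_zero_iff.2 hx
    exact ⟨‖x‖⁻¹ • x, by simp [norm_smul, this], by simp [smul_smul, this]⟩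

lemma norm_sub_add_le_of_closedBall_subset [Nontrivial E] {x c : E} {s R : ℝ} (hs : 0 ≤ s)
    (h : closedBall x s ⊆ closedBall c R) : ‖x - c‖ + s ≤ R := by
  obtain ⟨u, hu, hxu⟩ := exists_norm_eq_one_and_eq_smul (x - c)
  have hmem : x + s • u ∈ closedBall x s := by
    simp [norm_smul, hu, abs_of_nonneg hs]
  have h1 := h hmem
  rw [mem_closedBall, dist_eq_norm, show x + s • u - c = (x - c) + s • u by abel, hxu, ← add_smul,
    norm_smul, hu, mul_one, Real.norm_of_nonneg (by positivity)] at h1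
  exact h1

/-- `closedBall o r` is a largest ball contained in `K`. -/
def IsInball (K : Set E) (o : E) (r : ℝ) : Prop :=
  0 < r ∧ closedBall o r ⊆ K ∧ ∀ c s, 0 ≤ s → closedBall c s ⊆ K → s ≤ r

/-- The pairs (centre, radius) of balls inside `K` form a compact set, on which the radius attains
its maximum. -/
lemma exists_isInball [Nontrivial E] {K : Set E} (hK : IsCompact K)
    (hint : (interior K).Nonempty) : ∃ o r, IsInball K o r := by
  obtain ⟨D, hD⟩ := hK.isBounded.exists_norm_le
  set S : Set (E × ℝ) := {q | 0 ≤ q.2 ∧ closedBall q.1 q.2 ⊆ K}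
  have hS : S = {q : E × ℝ | 0 ≤ q.2} ∩ ⋂ u ∈ closedBall (0 : E) 1, {q : E × ℝ | q.1 + q.2 • u ∈ K} := by
    ext ⟨c, s⟩
    simp only [S, mem_ofPred_eq, mem_inter_iff, mem_iInter]
    refine and_congr_right fun hs => ⟨fun h u hu => h ?_, fun h y hy => ?_⟩
    · rw [mem_closedBall_zero_iff] at hu
      simp only [mem_closedBall, dist_self_add_left, norm_smul, Real.norm_of_nonneg hs]
      nlinarith
    · obtain ⟨u, hu, hyu⟩ := exists_norm_eq_one_and_eq_smul (y - c)
      rw [mem_closedBall, dist_eq_norm] at hy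
      rcases hs.eq_or_lt with h0 | h0
      · have : y = c := by
          rw [← h0] at hy
          exact sub_eq_zero.1 (norm_le_zero_iff.1 hy)
        simpa [← h0, this] using h 0 (by simp)
      · have h1 := h (s⁻¹ • (y - c)) (by
          rw [mem_closedBall_zero_iff, norm_smul, norm_inv, Real.norm_of_nonneg hs,
            inv_mul_le_iff₀ h0, mul_one]
          exact hy)
        rwa [smul_smul, mul_inv_cancel₀ h0.ne', one_smul, add_sub_cancel] at h1
  have hSclosed : IsClosed S := by
    rw [hS]
    refine (isClosed_le continuous_const continuous_snd).inter
      (isClosed_biInter fun u _ => hK.isClosed.preimage ?_)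
    fun_prop
  have hScomp : IsCompact S := by
    refine (hK.prod (isCompact_Icc : IsCompact (Icc (0 : ℝ) D))).of_isClosed_subset hSclosed ?_
    rintro ⟨c, s⟩ ⟨hs, h⟩
    refine ⟨h (mem_closedBall_self hs), hs, ?_⟩
    have := norm_sub_add_le_of_closedBall_subset (c := (0 : E)) (R := D) hs
      (h.trans fun y hy => by simpa using hD y hy)
    simp only at this ⊢
    linarith [norm_nonneg (c - 0)]
  obtain ⟨x, hx⟩ := hint
  obtain ⟨ε, hε, hxε⟩ := nhds_basis_closedBall.mem_iff.1 (mem_interior_iff_mem_nhds.1 hx)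
  obtain ⟨⟨o, r⟩, ⟨hr0, hr⟩, hmax⟩ := hScomp.exists_isMaxOn (⟨(x, ε), hε.le, hxε⟩ : S.Nonempty)
    continuous_snd.continuousOn
  refine ⟨o, r, hε.trans_le (hmax (⟨hε.le, hxε⟩ : (x, ε) ∈ S)), hr, fun c s hs h => ?_⟩
  exact hmax (⟨hs, h⟩ : (c, s) ∈ S)

/-- By Carathéodory, combinations of `dim + 1` points suffice, so the hull is a continuous image of
a simplex times a power of `T`; shorter combinations are padded with weight `0` at `t₀`. -/
lemma isCompact_convexHull [FiniteDimensional ℝ E] {T : Set E} (hT : IsCompact T) :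
    IsCompact (convexHull ℝ T) := by
  rcases T.eq_empty_or_nonempty with rfl | ⟨t₀, ht₀⟩
  · simp
  set N := Module.finrank ℝ E + 1
  let Φ : (Fin N → ℝ) × (Fin N → E) → E := fun q => ∑ i, q.1 i • q.2 i
  have hΦ : Continuous Φ := by fun_prop
  have himg : Φ '' (stdSimplex ℝ (Fin N) ×ˢ univ.pi fun _ => T) = convexHull ℝ T := by
    refine subset_antisymm ?_ fun x hx => ?_
    · rintro _ ⟨⟨w, z⟩, ⟨⟨hw0, hw1⟩, hz⟩, rfl⟩
      exact mem_convexHull_of_exists_fintype w z hw0 hw1 (fun i => hz i (mem_univ i)) rfl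
    · obtain ⟨ι, _, z, w, hzT, hz, hw0, hw1, hx⟩ := eq_pos_convex_span_of_mem_convexHull hx
      have hcard : Fintype.card ι ≤ Fintype.card (Fin N) := by
        rw [Fintype.card_fin]
        exact hz.card_le_finrank_succ.trans (Nat.succ_le_succ (Submodule.finrank_le _))
      obtain ⟨f⟩ := Function.Embedding.nonempty_of_card_le hcard
      have hw' : ∀ i ∉ range f, Function.extend f w 0 i = 0 := fun i hi =>
        Function.extend_apply' _ _ _ hi
      refine ⟨(Function.extend f w 0, Function.extend f z fun _ => t₀), ⟨⟨fun i => ?_, ?_⟩,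
        fun i _ => ?_⟩, ?_⟩
      · by_cases hi : i ∈ range f
        · obtain ⟨j, rfl⟩ := hi
          simp only [f.injective.extend_apply]
          exact (hw0 j).le
        · exact (hw' i hi).ge
      · rw [← hw1]
        exact (Fintype.sum_of_injective f f.injective _ _ hw'
          fun i => (f.injective.extend_apply _ _ _).symm).symm
      · by_cases hi : i ∈ range f
        · obtain ⟨j, rfl⟩ := hi
          simp only [f.injective.extend_apply]
          exact hzT (mem_range_self j)
        · simpa only [Function.extend_apply' _ _ _ hi] using ht₀
      · rw [← hx]
        refine (Fintype.sum_of_injective f f.injective _ _ (fun i hi => ?_) fun i => ?_).symm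
        · simp only [hw' i hi, zero_smul]
        · simp only [f.injective.extend_apply]
  rw [← himg]
  exact ((isCompact_stdSimplex ℝ (Fin N)).prod (isCompact_univ_pi fun _ => hT)).image hΦ

/-- The outer normals of the inball at its contact points surround the origin. -/
lemma zero_mem_convexHull_contact [FiniteDimensional ℝ E] {K : Set E} {o : E} {r : ℝ}
    (h : IsInball K o r) : (0 : E) ∈ convexHull ℝ {u : E | ‖u‖ = 1 ∧ o + r • u ∈ frontier K} := by
  obtain ⟨hr, hball, hmax⟩ := h
  set T : Set E := {u : E | ‖u‖ = 1 ∧ o + r • u ∈ frontier K}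
  have hT : IsCompact T := by
    refine (isCompact_sphere (0 : E) 1).of_isClosed_subset ?_ fun u hu => by simpa using hu.1
    exact (isClosed_eq continuous_norm continuous_const).inter
      (isClosed_frontier.preimage (by fun_prop))
  by_contra h0
  -- If `0` is separated from the contact normals by `v`, translating the inball by `-ε v` moves it
  -- into the interior of `K`, where it can be enlarged.
  obtain ⟨f, δ, hδ, hf⟩ := geometric_hahn_banach_point_closed (convex_convexHull ℝ T)
    (isCompact_convexHull hT).isClosed h0
  rw [map_zero] at hδ
  obtain ⟨v, hv⟩ : ∃ v : E, ∀ x, f x = ⟪v, x⟫ :=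
    ⟨(InnerProductSpace.toDual ℝ E).symm f, fun x => by simp⟩
  have hTv : ∀ u ∈ T, δ < ⟪v, u⟫ := fun u hu => by
    rw [← hv]; exact hf u (subset_convexHull ℝ T hu)
  have hball' : ball o r ⊆ interior K := interior_maximal (ball_subset_closedBall.trans hball) isOpen_ball
  have key : ∀ᶠ ε in 𝓝 (0 : ℝ), ∀ u ∈ closedBall (0 : E) 1,
      0 < ε → ‖u‖ ≤ 1 → o - ε • v + r • u ∈ interior K := by
    refine (isCompact_closedBall (0 : E) 1).eventually_forall_of_forall_eventually
      (P := fun ε u => 0 < ε → ‖u‖ ≤ 1 → o - ε • v + r • u ∈ interior K) fun u hu => ?_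
    by_cases hi : o + r • u ∈ interior K
    · have hc : Continuous fun z : ℝ × E => o - z.1 • v + r • z.2 := by fun_prop
      have : ∀ᶠ z : ℝ × E in 𝓝 (0, u), o - z.1 • v + r • z.2 ∈ interior K :=
        hc.tendsto (0, u) (by simpa using isOpen_interior.mem_nhds hi)
      filter_upwards [this] with z hz _ _ using hz
    · rw [mem_closedBall_zero_iff] at hu
      have hu1 : ‖u‖ = 1 := by
        refine le_antisymm hu ?_
        by_contra! hlt
        refine hi (hball' ?_)
        rw [mem_ball, dist_self_add_left, norm_smul, Real.norm_of_nonneg hr.le]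
        nlinarith
      have huK : o + r • u ∈ K := hball (by
        rw [mem_closedBall, dist_self_add_left, norm_smul, Real.norm_of_nonneg hr.le, hu1, mul_one])
      have huT : u ∈ T := ⟨hu1, subset_closure huK, hi⟩
      have hc1 : Continuous fun z : ℝ × E => ⟪v, z.2⟫ := by fun_prop
      have hc2 : Continuous fun z : ℝ × E => z.1 * ‖v‖ ^ 2 := by fun_prop
      have ev1 : ∀ᶠ z : ℝ × E in 𝓝 (0, u), δ < ⟪v, z.2⟫ :=
        (hc1.tendsto (0, u)).eventually (lt_mem_nhds (hTv u huT))
      have ev2 : ∀ᶠ z : ℝ × E in 𝓝 (0, u), z.1 * ‖v‖ ^ 2 < 2 * r * δ :=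
        (hc2.tendsto (0, u)).eventually (gt_mem_nhds (by simp only [zero_mul]; positivity))
      filter_upwards [ev1, ev2] with z hz1 hz2 hz0 hzu
      refine hball' ?_
      rw [mem_ball, dist_eq_norm, show o - z.1 • v + r • z.2 - o = r • z.2 - z.1 • v by abel]
      refine lt_of_pow_lt_pow_left₀ 2 hr.le ?_
      rw [norm_sub_sq_real, norm_smul, norm_smul, real_inner_smul_left, real_inner_smul_right,
        mul_pow, mul_pow, Real.norm_eq_abs, Real.norm_eq_abs, sq_abs, sq_abs, real_inner_comm]
      have h1 : ‖z.2‖ ^ 2 ≤ 1 := by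
        have := norm_nonneg z.2
        nlinarith
      have h2 : r ^ 2 * ‖z.2‖ ^ 2 ≤ r ^ 2 := by nlinarith [sq_nonneg r]
      have h3 : z.1 * (z.1 * ‖v‖ ^ 2) < z.1 * (2 * r * δ) := by gcongr
      have h4 : z.1 * r * δ < z.1 * r * ⟪v, z.2⟫ := by gcongr
      nlinarith
  obtain ⟨ε, hε, hε0⟩ :=
    ((key.filter_mono nhdsWithin_le_nhds).and (self_mem_nhdsWithin (s := Ioi (0 : ℝ)))).exists
  have hsub : closedBall (o - ε • v) r ⊆ interior K := by
    intro y hy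
    rw [mem_closedBall, dist_eq_norm] at hy
    have hn : ‖r⁻¹ • (y - (o - ε • v))‖ ≤ 1 := by
      rw [norm_smul, norm_inv, Real.norm_of_nonneg hr.le, inv_mul_le_iff₀ hr, mul_one]
      exact hy
    have := hε (r⁻¹ • (y - (o - ε • v))) (by simpa using hn) hε0 hn
    rwa [smul_smul, mul_inv_cancel₀ hr.ne', one_smul, add_sub_cancel] at this
  obtain ⟨η, hη, hthick⟩ := (isCompact_closedBall (o - ε • v) r).exists_thickening_subset_open
    isOpen_interior hsub
  rw [thickening_closedBall hη hr.le] at hthick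
  have := hmax (o - ε • v) (r + η / 2) (by positivity)
    (((closedBall_subset_ball (by linarith)).trans hthick).trans interior_subset)
  linarith

/-- At a contact point with the inball, the supporting ball is determined, and it contains the
whole body. -/
lemma subset_closedBall_of_contact {K : Set E} (hK : IsClosed K)
    (hconv : Convex ℝ K) {R : ℝ} (hR : 0 < R) (hloc : LocallySupportedByBalls R K)
    (hdim : ∀ u : E, ∃ w : E, w ≠ 0 ∧ ⟪u, w⟫ = 0) {o u : E} {r : ℝ} (h : IsInball K o r)
    (hu : ‖u‖ = 1) (hp : o + r • u ∈ frontier K) :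
    K ⊆ closedBall (o - (R - r) • u) R := by
  obtain ⟨hr, hball, -⟩ := h
  obtain ⟨U, hU, c, hc, hUK⟩ := hloc _ hp
  have hint : (interior K).Nonempty :=
    ⟨o, interior_mono hball (ball_subset_interior_closedBall (mem_ball_self hr))⟩
  have hsub := subset_closedBall_of_locallySupportedByBalls hK hconv hint hR hloc hdim hp hU hc hUK
  rw [mem_sphere, dist_eq_norm] at hc
  -- The test point is the point of the inball farthest in direction `g = p - c`; it forces `⟪u, g⟫
  -- ≥ R = ‖g‖`, hence `g = R u`.
  have hnp := inner_sub_nonpos_of_locally_subset_closedBall hconv hU (hK.frontier_subset hp)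
    (by rwa [mem_sphere, dist_eq_norm]) hUK (y := o + (r / R) • (o + r • u - c)) (hball (by
      rw [mem_closedBall, dist_self_add_left, norm_smul, hc, Real.norm_of_nonneg (by positivity),
        div_mul_cancel₀ _ hR.ne']))
  set g := o + r • u - c
  rw [show o + (r / R) • g - (o + r • u) = (r / R) • g - r • u by abel, inner_sub_left,
    real_inner_smul_left, real_inner_smul_left, real_inner_self_eq_norm_sq, hc,
    show r / R * R ^ 2 = r * R by field_simp, ← mul_sub] at hnp
  have hge : R ≤ ⟪u, g⟫ := by
    by_contra! hlt
    nlinarith [mul_pos hr (sub_pos.2 hlt)]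
  have hg : g = R • u := by
    have : ‖g - R • u‖ ^ 2 ≤ 0 := by
      rw [norm_sub_sq_real, hc, norm_smul, hu, real_inner_smul_right, real_inner_comm,
        Real.norm_of_nonneg hR.le]
      nlinarith
    have h0 : ‖g - R • u‖ ^ 2 = 0 := le_antisymm this (by positivity)
    simpa [sub_eq_zero] using h0
  have : c = o - (R - r) • u := by
    rw [sub_smul, ← hg]
    simp only [g]
    abel
  rwa [← this]

end ReverseInradius

end Inball

/-! ### Width bounds for intersections of balls and for lenses. -/

section Width

open MeasureTheory Metric Set
open scoped Pointwise Topology RealInnerProductSpace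

namespace ReverseInradius

/-- Half the width, in a direction at angle `arccos s` to the axis, of the lens cut out by two
balls of radius `R` with centres at distance `2 * d`. -/
noncomputable def lensHalfWidth (R d s : ℝ) : ℝ :=
  sInf ((fun τ : ℝ => √(R ^ 2 - d ^ 2 + d ^ 2 * τ ^ 2) - d * τ * |s|) '' Icc 0 1)

section LensHalfWidth

variable (R d : ℝ)

lemma continuous_lensHalfWidth : Continuous (lensHalfWidth R d) :=
  isCompact_Icc.continuous_sInf
    (f := fun s τ : ℝ => √(R ^ 2 - d ^ 2 + d ^ 2 * τ ^ 2) - d * τ * |s|) (by fun_prop)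

lemma exists_lensHalfWidth_eq (s : ℝ) : ∃ τ ∈ Icc (0 : ℝ) 1,
    lensHalfWidth R d s = √(R ^ 2 - d ^ 2 + d ^ 2 * τ ^ 2) - d * τ * |s| := by
  obtain ⟨τ, hτ, h⟩ := (isCompact_Icc.image (by fun_prop : Continuous fun τ : ℝ =>
    √(R ^ 2 - d ^ 2 + d ^ 2 * τ ^ 2) - d * τ * |s|)).sInf_mem
    ((nonempty_Icc.2 zero_le_one).image _)
  exact ⟨τ, hτ, h.symm⟩

lemma lensHalfWidth_le (s : ℝ) {τ : ℝ} (hτ : τ ∈ Icc (0 : ℝ) 1) :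
    lensHalfWidth R d s ≤ √(R ^ 2 - d ^ 2 + d ^ 2 * τ ^ 2) - d * τ * |s| :=
  csInf_le (isCompact_Icc.image (by fun_prop : Continuous fun τ : ℝ =>
    √(R ^ 2 - d ^ 2 + d ^ 2 * τ ^ 2) - d * τ * |s|)).bddBelow (mem_image_of_mem _ hτ)

lemma le_lensHalfWidth {s a : ℝ} (h : ∀ τ ∈ Icc (0 : ℝ) 1,
    a ≤ √(R ^ 2 - d ^ 2 + d ^ 2 * τ ^ 2) - d * τ * |s|) : a ≤ lensHalfWidth R d s := by
  obtain ⟨τ, hτ, e⟩ := exists_lensHalfWidth_eq R d s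
  rw [e]
  exact h τ hτ

lemma lensHalfWidth_abs (s : ℝ) : lensHalfWidth R d |s| = lensHalfWidth R d s := by
  simp only [lensHalfWidth, abs_abs]

variable {R d}

lemma lensHalfWidth_anti (hd : 0 ≤ d) {s t : ℝ} (hst : |s| ≤ |t|) :
    lensHalfWidth R d t ≤ lensHalfWidth R d s := by
  obtain ⟨τ, hτ, e⟩ := exists_lensHalfWidth_eq R d s
  rw [e]
  refine (lensHalfWidth_le R d t hτ).trans ?_
  have : 0 ≤ d * τ := mul_nonneg hd hτ.1
  gcongr

/-- A minimiser `τ > 0` at `s` does strictly better at `1`. If `τ = 0`, the comparison is `R - d <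
√(R² - d²)`. -/
lemma lensHalfWidth_one_lt (hd : 0 < d) (hdR : d < R) {s : ℝ} (hs : |s| < 1) :
    lensHalfWidth R d 1 < lensHalfWidth R d s := by
  obtain ⟨τ, hτ, e⟩ := exists_lensHalfWidth_eq R d s
  rw [e]
  rcases hτ.1.eq_or_lt with h | h
  · refine (lensHalfWidth_le R d 1 (right_mem_Icc.2 zero_le_one)).trans_lt ?_
    have h1 : √(R ^ 2 - d ^ 2 + d ^ 2 * 1 ^ 2) = R := by
      rw [show R ^ 2 - d ^ 2 + d ^ 2 * 1 ^ 2 = R ^ 2 by ring]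
      exact Real.sqrt_sq (hd.le.trans hdR.le)
    rw [h1, ← h, abs_one]
    simp only [mul_zero, zero_mul, sub_zero, mul_one]
    refine Real.lt_sqrt_of_sq_lt ?_
    nlinarith
  · refine (lensHalfWidth_le R d 1 hτ).trans_lt ?_
    rw [abs_one]
    have : d * τ * |s| < d * τ * 1 := by gcongr
    linarith

/-- An infimum of concave functions of `s` is concave; this is the chord inequality on `[-m, M]`,
with evenness used at `-m`. -/
lemma lensHalfWidth_chord (hd : 0 ≤ d) {m M a : ℝ} (hm : 0 ≤ m) (hM : 0 ≤ M) (ha : -m ≤ a)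
    (ha' : a ≤ M) : (M - a) * lensHalfWidth R d m + (a + m) * lensHalfWidth R d M
      ≤ (M + m) * lensHalfWidth R d a := by
  obtain ⟨τ, hτ, e⟩ := exists_lensHalfWidth_eq R d a
  have h1 := lensHalfWidth_le R d m hτ
  have h2 := lensHalfWidth_le R d M hτ
  rw [abs_of_nonneg hm] at h1
  rw [abs_of_nonneg hM] at h2
  rw [e]
  set C := √(R ^ 2 - d ^ 2 + d ^ 2 * τ ^ 2)
  have hdτ : 0 ≤ d * τ := mul_nonneg hd hτ.1
  have h3 := mul_le_mul_of_nonneg_left h1 (by linarith : 0 ≤ M - a)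
  have h4 := mul_le_mul_of_nonneg_left h2 (by linarith : 0 ≤ a + m)
  have h5 : (M + m) * |a| ≤ (M - a) * m + (a + m) * M := by
    rcases abs_cases a with ⟨h, h'⟩ | ⟨h, h'⟩ <;> rw [h]
    · nlinarith
    · nlinarith
  nlinarith [mul_le_mul_of_nonneg_left h5 hdτ]

lemma chord_sum_le {ι : Type*} [Fintype ι] (hd : 0 ≤ d) {w a : ι → ℝ} (hw : ∀ i, 0 ≤ w i)
    (hw1 : ∑ i, w i = 1) (hwa : ∑ i, w i * a i = 0) {m M : ℝ} (hm : 0 ≤ m) (hM : 0 ≤ M)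
    (ha : ∀ i, -m ≤ a i) (ha' : ∀ i, a i ≤ M) :
    M * lensHalfWidth R d m + m * lensHalfWidth R d M
      ≤ (M + m) * ∑ i, w i * lensHalfWidth R d (a i) := by
  have h : ∑ i, w i * ((M - a i) * lensHalfWidth R d m + (a i + m) * lensHalfWidth R d M)
      ≤ ∑ i, w i * ((M + m) * lensHalfWidth R d (a i)) :=
    Finset.sum_le_sum fun i _ => mul_le_mul_of_nonneg_left
      (lensHalfWidth_chord hd hm hM (ha i) (ha' i)) (hw i)
  have e1 : ∑ i, w i * ((M - a i) * lensHalfWidth R d m + (a i + m) * lensHalfWidth R d M)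
      = (∑ i, w i) * (M * lensHalfWidth R d m + m * lensHalfWidth R d M)
        + (∑ i, w i * a i) * (lensHalfWidth R d M - lensHalfWidth R d m) := by
    rw [Finset.sum_mul, Finset.sum_mul, ← Finset.sum_add_distrib]
    exact Finset.sum_congr rfl fun i _ => by ring
  have e2 : ∑ i, w i * ((M + m) * lensHalfWidth R d (a i))
      = (M + m) * ∑ i, w i * lensHalfWidth R d (a i) := by
    rw [Finset.mul_sum]
    exact Finset.sum_congr rfl fun i _ => by ring
  rw [e1, e2, hw1, hwa] at h
  linarith

/-- The averaged chord inequality weights `φ(m)` by `M` and `φ(M)` by `m`. As `φ` is nonincreasing,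
the heavier weight falls on the larger value, so equal weights give no more. -/
lemma lensHalfWidth_add_le {ι : Type*} [Fintype ι] (hd : 0 ≤ d) {w a : ι → ℝ} (hw : ∀ i, 0 ≤ w i)
    (hw1 : ∑ i, w i = 1) (hwa : ∑ i, w i * a i = 0) {m M : ℝ} (hm : 0 ≤ m) (hM : 0 ≤ M)
    (ha : ∀ i, -m ≤ a i) (ha' : ∀ i, a i ≤ M) :
    lensHalfWidth R d M + lensHalfWidth R d m ≤ 2 * ∑ i, w i * lensHalfWidth R d (a i) := by
  have h := chord_sum_le (R := R) hd hw hw1 hwa hm hM ha ha'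
  rcases (add_nonneg hM hm).eq_or_lt with h0 | h0
  · have hM0 : M = 0 := by linarith
    have hm0 : m = 0 := by linarith
    have ha0 : ∀ i, a i = 0 := fun i => le_antisymm (by linarith [ha' i]) (by linarith [ha i])
    simp only [ha0, ← Finset.sum_mul, hw1, hM0, hm0]
    linarith
  · have h1 : 0 ≤ (M - m) * (lensHalfWidth R d m - lensHalfWidth R d M) := by
      rcases le_total m M with h | h
      · exact mul_nonneg (by linarith) (sub_nonneg.2 (lensHalfWidth_anti hd
          (by rwa [abs_of_nonneg hm, abs_of_nonneg hM])))
      · exact mul_nonneg_of_nonpos_of_nonpos (by linarith) (sub_nonpos.2 (lensHalfWidth_anti hd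
          (by rwa [abs_of_nonneg hm, abs_of_nonneg hM])))
    refine le_of_mul_le_mul_left ?_ h0
    nlinarith

lemma lensHalfWidth_one_add_lt {ι : Type*} [Fintype ι] (hd : 0 < d) (hdR : d < R) {w a : ι → ℝ}
    (hw : ∀ i, 0 ≤ w i) (hw1 : ∑ i, w i = 1) (hwa : ∑ i, w i * a i = 0) {m : ℝ} (hm : 0 ≤ m)
    (hm1 : m < 1) (ha : ∀ i, -m ≤ a i) (ha' : ∀ i, a i ≤ 1) :
    lensHalfWidth R d 1 + lensHalfWidth R d m < 2 * ∑ i, w i * lensHalfWidth R d (a i) := by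
  have h := chord_sum_le (R := R) hd.le hw hw1 hwa hm zero_le_one ha ha'
  have h1 := lensHalfWidth_one_lt (s := m) hd hdR (by rwa [abs_of_nonneg hm])
  refine lt_of_mul_lt_mul_left (a := 1 + m) ?_ (by linarith)
  nlinarith [mul_pos (sub_pos.2 hm1) (sub_pos.2 h1)]

end LensHalfWidth

variable {E : Type*} [NormedAddCommGroup E] [InnerProductSpace ℝ E]

/-- A weighted system of unit vectors with barycentre `0` such that `K` lies in all the balls of
radius `R` with centres `o - d • z i`. -/
structure BalancedBalls (K : Set E) (o : E) (R d : ℝ) {ι : Type*} [Fintype ι] (w : ι → ℝ)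
    (z : ι → E) : Prop where
  nonneg : ∀ i, 0 ≤ w i
  sum_eq_one : ∑ i, w i = 1
  sum_smul_eq_zero : ∑ i, w i • z i = 0
  norm_eq_one : ∀ i, ‖z i‖ = 1
  subset : ∀ i, K ⊆ closedBall (o - d • z i) R

namespace BalancedBalls

variable {K : Set E} {o : E} {R d : ℝ} {ι : Type*} [Fintype ι] {w : ι → ℝ} {z : ι → E}
  (h : BalancedBalls K o R d w z)
include h

lemma norm_sq_add_le {x : E} (hx : x ∈ K) (i : ι) :
    ‖x - o‖ ^ 2 + 2 * d * ⟪x - o, z i⟫ + d ^ 2 ≤ R ^ 2 := by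
  have h1 := h.subset i hx
  rw [mem_closedBall, dist_eq_norm, show x - (o - d • z i) = (x - o) + d • z i by abel] at h1
  have h2 : ‖(x - o) + d • z i‖ ^ 2 ≤ R ^ 2 := by gcongr
  rw [norm_add_sq_real, real_inner_smul_right, norm_smul, h.norm_eq_one, mul_one, Real.norm_eq_abs,
    sq_abs] at h2
  linarith

/-- Averaging the ball inequalities with the weights `w` kills the linear term. -/
lemma norm_sq_le {x : E} (hx : x ∈ K) : ‖x - o‖ ^ 2 ≤ R ^ 2 - d ^ 2 := by
  have h1 : ∑ i, w i * (‖x - o‖ ^ 2 + 2 * d * ⟪x - o, z i⟫ + d ^ 2) ≤ ∑ i, w i * R ^ 2 :=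
    Finset.sum_le_sum fun i _ => mul_le_mul_of_nonneg_left (h.norm_sq_add_le hx i) (h.nonneg i)
  have h2 : ∑ i, w i * ⟪x - o, z i⟫ = 0 := by
    have : ⟪x - o, ∑ i, w i • z i⟫ = ∑ i, w i * ⟪x - o, z i⟫ := by
      rw [inner_sum]
      exact Finset.sum_congr rfl fun i _ => real_inner_smul_right _ _ _
    rw [← this, h.sum_smul_eq_zero, inner_zero_right]
  have e : ∑ i, w i * (‖x - o‖ ^ 2 + 2 * d * ⟪x - o, z i⟫ + d ^ 2)
      = (∑ i, w i) * (‖x - o‖ ^ 2 + d ^ 2) + 2 * d * ∑ i, w i * ⟪x - o, z i⟫ := by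
    rw [Finset.sum_mul, Finset.mul_sum, ← Finset.sum_add_distrib]
    exact Finset.sum_congr rfl fun i _ => by ring
  rw [e, h2, ← Finset.sum_mul, h.sum_eq_one] at h1
  linarith

/-- Mixing the inequality of the `i`-th ball (weight `τ`) with the averaged one (weight `1 - τ`)
bounds `‖x - o + d τ z_i‖`; Cauchy–Schwarz against `v` gives the expression minimised over `τ` in
`lensHalfWidth`. -/
lemma supportFun_le (hne : K.Nonempty) {v : E} (hv : ‖v‖ = 1) (i : ι) (hi : 0 ≤ ⟪z i, v⟫) :
    supportFun K v ≤ ⟪o, v⟫ + lensHalfWidth R d ⟪z i, v⟫ := by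
  refine ReverseInradius.supportFun_le hne fun x hx => ?_
  rw [← sub_le_iff_le_add', ← inner_sub_left]
  refine le_lensHalfWidth R d fun τ hτ => ?_
  rw [abs_of_nonneg hi, le_sub_iff_add_le]
  have h1 := h.norm_sq_add_le hx i
  have h2 := h.norm_sq_le hx
  have h3 : ‖(x - o) + (d * τ) • z i‖ ^ 2 ≤ R ^ 2 - d ^ 2 + d ^ 2 * τ ^ 2 := by
    rw [norm_add_sq_real, real_inner_smul_right, norm_smul, h.norm_eq_one, mul_one,
      Real.norm_eq_abs, sq_abs]
    nlinarith [mul_le_mul_of_nonneg_left h1 hτ.1, mul_le_mul_of_nonneg_left h2 (sub_nonneg.2 hτ.2)]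
  have h4 := real_inner_le_norm ((x - o) + (d * τ) • z i) v
  rw [inner_add_left, real_inner_smul_left, hv, mul_one] at h4
  exact h4.trans (Real.le_sqrt_of_sq_le h3)

lemma sum_mul_inner (v : E) : ∑ i, w i * ⟪z i, v⟫ = 0 := by
  have : ⟪∑ i, w i • z i, v⟫ = ∑ i, w i * ⟪z i, v⟫ := by
    rw [sum_inner]
    exact Finset.sum_congr rfl fun i _ => real_inner_smul_left _ _ _
  rw [← this, h.sum_smul_eq_zero, inner_zero_left]

lemma nonempty : Nonempty ι := by
  by_contra hne
  rw [not_nonempty_iff] at hne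
  simpa using h.sum_eq_one

lemma exists_max_inner (v : E) : ∃ i, 0 ≤ ⟪z i, v⟫ ∧ ∀ j, ⟪z j, v⟫ ≤ ⟪z i, v⟫ := by
  have := h.nonempty
  obtain ⟨i, hi⟩ := Finite.exists_max fun i => ⟪z i, v⟫
  refine ⟨i, ?_, hi⟩
  calc 0 = ∑ j, w j * ⟪z j, v⟫ := (h.sum_mul_inner v).symm
    _ ≤ ∑ j, w j * ⟪z i, v⟫ :=
      Finset.sum_le_sum fun j _ => mul_le_mul_of_nonneg_left (hi j) (h.nonneg j)
    _ = ⟪z i, v⟫ := by rw [← Finset.sum_mul, h.sum_eq_one, one_mul]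

lemma width_le (hne : K.Nonempty) (hd : 0 ≤ d) {v : E} (hv : ‖v‖ = 1) :
    supportFun K v + supportFun K (-v) ≤ 2 * ∑ i, w i * lensHalfWidth R d ⟪z i, v⟫ := by
  obtain ⟨i, hi0, hi⟩ := h.exists_max_inner v
  obtain ⟨j, hj0, hj⟩ := h.exists_max_inner (-v)
  have h1 := h.supportFun_le hne hv i hi0
  have h2 := h.supportFun_le hne (by rwa [norm_neg] : ‖-v‖ = 1) j hj0
  have h3 := lensHalfWidth_add_le (R := R) hd h.nonneg h.sum_eq_one (h.sum_mul_inner v) hj0 hi0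
    (fun k => by have := hj k; rw [inner_neg_right] at this; linarith) hi
  rw [inner_neg_right] at h2
  linarith

/-- In direction `z i` the upper extreme is `1`, and the averaged inequality is strict unless the
lower extreme is `-1`. -/
lemma exists_eq_neg_of_width_eq (hne : K.Nonempty) (hd : 0 < d) (hdR : d < R) (i : ι)
    (heq : supportFun K (z i) + supportFun K (-z i)
      = 2 * ∑ j, w j * lensHalfWidth R d ⟪z j, z i⟫) : ∃ j, z j = -z i := by
  obtain ⟨j, hj0, hj⟩ := h.exists_max_inner (-z i)
  refine ⟨j, ?_⟩
  have hle : ⟪z j, -z i⟫ ≤ 1 := by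
    have := real_inner_le_norm (z j) (-z i)
    rwa [norm_neg, h.norm_eq_one, h.norm_eq_one, one_mul] at this
  have hzi : ⟪z i, z i⟫ = 1 := by rw [real_inner_self_eq_norm_sq, h.norm_eq_one, one_pow]
  rcases hle.lt_or_eq with hlt | he
  · exfalso
    have h1 := h.supportFun_le hne (h.norm_eq_one i) i (by rw [hzi]; exact zero_le_one)
    have h2 := h.supportFun_le hne (by rw [norm_neg, h.norm_eq_one] : ‖-z i‖ = 1) j hj0
    have h3 := lensHalfWidth_one_add_lt hd hdR h.nonneg h.sum_eq_one (h.sum_mul_inner (z i)) hj0 hlt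
      (fun k => by have := hj k; rw [inner_neg_right] at this; linarith)
      (fun k => by
        have := real_inner_le_norm (z k) (z i)
        rwa [h.norm_eq_one, h.norm_eq_one, one_mul] at this)
    rw [hzi] at h1
    rw [inner_neg_right o] at h2
    linarith
  · have h1 : ‖z j - -z i‖ ^ 2 = 0 := by
      rw [norm_sub_sq_real, he, norm_neg, h.norm_eq_one, h.norm_eq_one]
      norm_num
    exact sub_eq_zero.1 (norm_eq_zero.1 (pow_eq_zero_iff two_ne_zero |>.1 h1))

end BalancedBalls

/-- The lens with midpoint `o` and axis `e`. -/
def lens (o e : E) (R d : ℝ) : Set E := closedBall (o - d • e) R ∩ closedBall (o + d • e) R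

lemma isCompact_lens [FiniteDimensional ℝ E] (o e : E) (R d : ℝ) : IsCompact (lens o e R d) :=
  (isCompact_closedBall _ _).inter (isCompact_closedBall _ _)

lemma lens_neg (o e : E) (R d : ℝ) : lens o (-e) R d = lens o e R d := by
  simp only [lens, smul_neg, sub_neg_eq_add, ← sub_eq_add_neg, inter_comm]

lemma closedBall_subset_lens {o e : E} (he : ‖e‖ = 1) {R d : ℝ} (hd : 0 ≤ d) :
    closedBall o (R - d) ⊆ lens o e R d := by
  refine subset_inter (closedBall_subset_closedBall' ?_) (closedBall_subset_closedBall' ?_) <;>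
  simp [dist_eq_norm, norm_smul, he, abs_of_nonneg hd]

lemma le_of_closedBall_subset_lens [Nontrivial E] {o e : E} (he : ‖e‖ = 1) {R d : ℝ}
    (hd : 0 ≤ d) {c : E} {s : ℝ} (hs : 0 ≤ s) (h : closedBall c s ⊆ lens o e R d) : s ≤ R - d := by
  have h1 := norm_sub_add_le_of_closedBall_subset hs (h.trans inter_subset_left)
  have h2 := norm_sub_add_le_of_closedBall_subset hs (h.trans inter_subset_right)
  have h3 : ‖(c - (o - d • e)) - (c - (o + d • e))‖ ≤ ‖c - (o - d • e)‖ + ‖c - (o + d • e)‖ :=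
    norm_sub_le _ _
  rw [show (c - (o - d • e)) - (c - (o + d • e)) = (2 * d) • e by module, norm_smul, he, mul_one,
    Real.norm_of_nonneg (by positivity)] at h3
  linarith

lemma isInball_lens [Nontrivial E] {o e : E} (he : ‖e‖ = 1) {R d : ℝ} (hd : 0 ≤ d) (hdR : d < R) :
    IsInball (lens o e R d) o (R - d) :=
  ⟨by linarith, closedBall_subset_lens he hd,
    fun _ _ hs h => le_of_closedBall_subset_lens he hd hs h⟩

lemma balancedBalls_lens {o e : E} (he : ‖e‖ = 1) (R d : ℝ) :
    BalancedBalls (lens o e R d) o R d (fun _ : Bool => (1 / 2 : ℝ)) (fun b => cond b e (-e)) where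
  nonneg _ := by norm_num
  sum_eq_one := by simp
  sum_smul_eq_zero := by simp
  norm_eq_one b := by cases b <;> simp [he]
  subset b := by
    cases b
    · rw [cond_false, smul_neg, sub_neg_eq_add]
      exact inter_subset_right
    · exact inter_subset_left

/-- A point of the lens reaches the bound: on the spherical cap when `d ≤ R * ⟪e, v⟫` (taking `τ =
1`), on the rim otherwise. -/
lemma lensHalfWidth_le_supportFun_lens [FiniteDimensional ℝ E] {o e v : E} (he : ‖e‖ = 1)
    (hv : ‖v‖ = 1) {R d : ℝ} (hd : 0 ≤ d) (hdR : d < R) :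
    ⟪o, v⟫ + lensHalfWidth R d ⟪e, v⟫ ≤ supportFun (lens o e R d) v := by
  wlog hs : 0 ≤ ⟪e, v⟫ generalizing e
  · have := this (e := -e) (by rwa [norm_neg]) (by rw [inner_neg_left]; linarith)
    rwa [lens_neg, inner_neg_left, ← lensHalfWidth_abs, abs_neg, lensHalfWidth_abs] at this
  set s := ⟪e, v⟫
  have hve : ⟪v, e⟫ = s := real_inner_comm _ _
  have hR : 0 < R := hd.trans_lt hdR
  have hs1 : s ≤ 1 := by
    have := real_inner_le_norm e v
    rwa [he, hv, one_mul] at this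
  suffices hx : ∃ x : E, ‖x + d • e‖ ^ 2 ≤ R ^ 2 ∧ ‖x - d • e‖ ^ 2 ≤ R ^ 2 ∧
      lensHalfWidth R d s ≤ ⟪x, v⟫ by
    obtain ⟨x, h1, h2, h3⟩ := hx
    have hmem : o + x ∈ lens o e R d := by
      constructor <;> rw [mem_closedBall, dist_eq_norm]
      · rw [show o + x - (o - d • e) = x + d • e by abel]
        exact le_of_sq_le_sq h1 hR.le
      · rw [show o + x - (o + d • e) = x - d • e by abel]
        exact le_of_sq_le_sq h2 hR.le
    have := inner_le_supportFun (isCompact_lens o e R d) v hmem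
    rw [inner_add_left] at this
    linarith
  rcases le_or_gt d (R * s) with hds | hds
  · refine ⟨R • v - d • e, ?_, ?_, ?_⟩
    · rw [sub_add_cancel, norm_smul, hv, mul_one, Real.norm_of_nonneg hR.le]
    · rw [show R • v - d • e - d • e = R • v - (2 * d) • e by module, norm_sub_sq_real, norm_smul,
        norm_smul, hv, he, real_inner_smul_left, real_inner_smul_right, hve,
        Real.norm_of_nonneg hR.le, Real.norm_of_nonneg (by positivity)]
      nlinarith [mul_nonneg hd (sub_nonneg.2 hds)]
    · refine (lensHalfWidth_le R d s (right_mem_Icc.2 zero_le_one)).trans ?_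
      rw [inner_sub_left, real_inner_smul_left, real_inner_smul_left, real_inner_self_eq_norm_sq, hv,
        show R ^ 2 - d ^ 2 + d ^ 2 * 1 ^ 2 = R ^ 2 by ring, Real.sqrt_sq hR.le, abs_of_nonneg hs]
      change _ ≤ R * 1 ^ 2 - d * s
      linarith
  · have hd0 : 0 < d := lt_of_le_of_lt (by positivity) hds
    have hs1' : s < 1 := by nlinarith
    set ρ := √(R ^ 2 - d ^ 2)
    have hρpos : 0 < R ^ 2 - d ^ 2 := by nlinarith
    have hρ : ρ ^ 2 = R ^ 2 - d ^ 2 := Real.sq_sqrt hρpos.le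
    have hρ0 : 0 < ρ := Real.sqrt_pos.2 hρpos
    set c := √(1 - s ^ 2)
    have hcpos : 0 < 1 - s ^ 2 := by nlinarith
    have hc : c ^ 2 = 1 - s ^ 2 := Real.sq_sqrt hcpos.le
    have hc0 : 0 < c := Real.sqrt_pos.2 hcpos
    have hn : ‖v - s • e‖ ^ 2 = c ^ 2 := by
      rw [norm_sub_sq_real, norm_smul, hv, he, real_inner_smul_right, hve, Real.norm_of_nonneg hs, hc]
      ring
    have hoe : ⟪v - s • e, e⟫ = 0 := by
      rw [inner_sub_left, real_inner_smul_left, real_inner_self_eq_norm_sq, he, hve]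
      ring
    have hx2 : ‖(ρ / c) • (v - s • e)‖ ^ 2 = ρ ^ 2 := by
      rw [norm_smul, mul_pow, hn, Real.norm_of_nonneg (by positivity)]
      field_simp
    have hde : ‖d • e‖ ^ 2 = d ^ 2 := by
      rw [norm_smul, he, mul_one, Real.norm_of_nonneg hd]
    refine ⟨(ρ / c) • (v - s • e), ?_, ?_, ?_⟩
    · rw [norm_add_sq_real, hx2, hde, real_inner_smul_left, real_inner_smul_right, hoe, hρ]
      linarith
    · rw [norm_sub_sq_real, hx2, hde, real_inner_smul_left, real_inner_smul_right, hoe, hρ]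
      linarith
    -- The critical point of `τ ↦ √(ρ² + d² τ²) - d τ s`.
    · have hτ : ρ * s / (d * c) ∈ Icc (0 : ℝ) 1 := by
        refine ⟨by positivity, ?_⟩
        rw [div_le_one (by positivity)]
        refine le_of_sq_le_sq ?_ (by positivity)
        rw [mul_pow, mul_pow, hρ, hc]
        have : (R * s) ^ 2 ≤ d ^ 2 := by gcongr
        nlinarith
      refine (lensHalfWidth_le R d s hτ).trans (le_of_eq ?_)
      have e1 : R ^ 2 - d ^ 2 + d ^ 2 * (ρ * s / (d * c)) ^ 2 = (ρ / c) ^ 2 := by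
        rw [← hρ]
        field_simp
        rw [hc]
        ring
      rw [e1, Real.sqrt_sq (by positivity), abs_of_nonneg hs, real_inner_smul_left, inner_sub_left,
        real_inner_smul_left, real_inner_self_eq_norm_sq, hv]
      change _ = ρ / c * (1 ^ 2 - s * s)
      field_simp

end ReverseInradius

end Width

/-! ### Integration over the sphere and the equality case. -/

section Comparison

open MeasureTheory Metric Set
open scoped Pointwise Topology RealInnerProductSpace

namespace ReverseInradius

lemma continuous_sum_lensHalfWidth {F : Type*} [NormedAddCommGroup F] [InnerProductSpace ℝ F]
    {ι : Type*} [Fintype ι] (w : ι → ℝ) (z : ι → F) (R d : ℝ) :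
    Continuous fun u : sphere (0 : F) 1 => 2 * ∑ i, w i * lensHalfWidth R d ⟪z i, u⟫ := by
  refine continuous_const.mul (continuous_finsetSum _ fun i _ => continuous_const.mul
    ((continuous_lensHalfWidth R d).comp (by fun_prop)))

variable {E : Type*} [NormedAddCommGroup E] [InnerProductSpace ℝ E] [FiniteDimensional ℝ E]
  [MeasurableSpace E] [BorelSpace E]

lemma integrable_sphere {f : sphere (0 : E) 1 → ℝ} (hf : Continuous f) :
    Integrable f (volume : Measure E).toSphere :=
  hf.integrable_of_hasCompactSupport (HasCompactSupport.of_compactSpace _)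

/-- The spherical measure of a set is a multiple of the volume of the cone over it, which isometries
preserve. -/
lemma integral_toSphere_comp_isometry (A : E ≃ₗᵢ[ℝ] E) {f : E → ℝ} (hf : Continuous f) :
    ∫ u : sphere (0 : E) 1, f (A u) ∂(volume : Measure E).toSphere
      = ∫ u : sphere (0 : E) 1, f u ∂(volume : Measure E).toSphere := by
  let φ : sphere (0 : E) 1 → sphere (0 : E) 1 := fun u => ⟨A u, by simp⟩
  have hφ : Continuous φ := by
    refine Continuous.subtype_mk ?_ _
    exact A.continuous.comp continuous_subtype_val
  have hmap : (volume : Measure E).toSphere.map φ = (volume : Measure E).toSphere := by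
    ext s hs
    rw [Measure.map_apply hφ.measurable hs, Measure.toSphere_apply' _ (hφ.measurable hs),
      Measure.toSphere_apply' _ hs]
    congr 1
    have himg : Ioo (0 : ℝ) 1 • ((↑) '' s : Set E) = A '' (Ioo (0 : ℝ) 1 • ((↑) '' (φ ⁻¹' s) : Set E)) := by
      ext y
      constructor
      · rintro ⟨t, ht, _, ⟨u, hu, rfl⟩, rfl⟩
        refine ⟨t • A.symm u, ⟨t, ht, A.symm u, ⟨⟨A.symm u, by simp⟩, ?_, rfl⟩, rfl⟩, by simp⟩
        simpa [φ] using hu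
      · rintro ⟨_, ⟨t, ht, _, ⟨u, hu, rfl⟩, rfl⟩, rfl⟩
        exact ⟨t, ht, A u, ⟨φ u, hu, rfl⟩, by simp⟩
    rw [himg, ← A.measurePreserving.measure_preimage_emb A.toMeasurableEquiv.measurableEmbedding (A '' _),
      preimage_image_eq _ A.injective]
  conv_rhs => rw [← hmap]
  exact (integral_map hφ.measurable.aemeasurable (f := fun u : sphere (0 : E) 1 => f u)
    (hf.comp continuous_subtype_val).aestronglyMeasurable).symm

lemma two_mul_integral_supportFun {K : Set E} (hK : IsCompact K) :
    2 * ∫ u : sphere (0 : E) 1, supportFun K u ∂(volume : Measure E).toSphere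
      = ∫ u : sphere (0 : E) 1, (supportFun K u + supportFun K (-u))
        ∂(volume : Measure E).toSphere := by
  have hc := continuous_supportFun hK
  have h := integral_toSphere_comp_isometry (LinearIsometryEquiv.neg ℝ) hc
  simp only [LinearIsometryEquiv.coe_neg] at h
  rw [integral_add (integrable_sphere (by fun_prop)) (integrable_sphere (by fun_prop)), h, two_mul]

lemma integral_lensHalfWidth_inner_eq (R d : ℝ) {z e : E} (hz : ‖z‖ = 1) (he : ‖e‖ = 1) :
    ∫ u : sphere (0 : E) 1, lensHalfWidth R d ⟪z, u⟫ ∂(volume : Measure E).toSphere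
      = ∫ u : sphere (0 : E) 1, lensHalfWidth R d ⟪e, u⟫ ∂(volume : Measure E).toSphere := by
  set A : E ≃ₗᵢ[ℝ] E := (ℝ ∙ (z - e))ᗮ.reflection
  have hA : A z = e := Submodule.reflection_sub (by rw [hz, he])
  have hc : Continuous fun v : E => lensHalfWidth R d ⟪e, v⟫ :=
    (continuous_lensHalfWidth R d).comp (by fun_prop)
  rw [← integral_toSphere_comp_isometry A hc, ← hA]
  simp only [LinearIsometryEquiv.inner_map_map]

/-- Equality almost everywhere becomes equality everywhere by continuity. -/
lemma eq_of_le_of_integral_eq {f g : sphere (0 : E) 1 → ℝ} (hf : Continuous f) (hg : Continuous g)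
    (hle : f ≤ g) (h : ∫ u, g u ∂(volume : Measure E).toSphere
      ≤ ∫ u, f u ∂(volume : Measure E).toSphere) : f = g := by
  have h0 : ∫ u, (g - f) u ∂(volume : Measure E).toSphere = 0 := by
    simp only [Pi.sub_apply]
    rw [integral_sub (integrable_sphere hg) (integrable_sphere hf)]
    exact sub_eq_zero.2 (le_antisymm h
      (integral_mono (integrable_sphere hf) (integrable_sphere hg) hle))
  have h1 := (integral_eq_zero_iff_of_nonneg (f := g - f) (fun u => sub_nonneg.2 (hle u))
    (integrable_sphere (hg.sub hf))).1 h0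
  exact (sub_eq_zero.1 ((hg.sub hf).ae_eq_iff_eq _ continuous_zero |>.1 h1)).symm

section BalancedBalls

variable {K : Set E} {o : E} {R d : ℝ} {ι : Type*} [Fintype ι] {w : ι → ℝ} {z : ι → E}

lemma BalancedBalls.integral_sum (h : BalancedBalls K o R d w z) {e : E} (he : ‖e‖ = 1) :
    ∫ u : sphere (0 : E) 1, 2 * ∑ i, w i * lensHalfWidth R d ⟪z i, u⟫
        ∂(volume : Measure E).toSphere
      = 2 * ∫ u : sphere (0 : E) 1, lensHalfWidth R d ⟪e, u⟫ ∂(volume : Measure E).toSphere := by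
  have hc : ∀ i, Continuous fun u : sphere (0 : E) 1 => w i * lensHalfWidth R d ⟪z i, u⟫ :=
    fun i => continuous_const.mul ((continuous_lensHalfWidth R d).comp (by fun_prop))
  rw [integral_const_mul, integral_finsetSum _ fun i _ => integrable_sphere (hc i)]
  simp only [integral_const_mul, integral_lensHalfWidth_inner_eq R d (h.norm_eq_one _) he]
  rw [← Finset.sum_mul, h.sum_eq_one, one_mul]

lemma BalancedBalls.integral_supportFun_le (h : BalancedBalls K o R d w z) (hK : IsCompact K)
    (hne : K.Nonempty) (hd : 0 ≤ d) {e : E} (he : ‖e‖ = 1) :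
    ∫ u : sphere (0 : E) 1, supportFun K u ∂(volume : Measure E).toSphere
      ≤ ∫ u : sphere (0 : E) 1, lensHalfWidth R d ⟪e, u⟫ ∂(volume : Measure E).toSphere := by
  have hc := continuous_supportFun hK
  have h1 : ∫ u : sphere (0 : E) 1, (supportFun K u + supportFun K (-u))
      ∂(volume : Measure E).toSphere ≤ _ :=
    integral_mono (integrable_sphere (by fun_prop)) (integrable_sphere (continuous_sum_lensHalfWidth w z R d))
      fun u => h.width_le hne hd (by simp)
  rw [h.integral_sum he, ← two_mul_integral_supportFun hK] at h1
  linarith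

lemma integral_lensHalfWidth_le {o e : E} (he : ‖e‖ = 1) (hd : 0 ≤ d) (hdR : d < R) :
    ∫ u : sphere (0 : E) 1, lensHalfWidth R d ⟪e, u⟫ ∂(volume : Measure E).toSphere
      ≤ ∫ u : sphere (0 : E) 1, supportFun (lens o e R d) u ∂(volume : Measure E).toSphere := by
  have hc := continuous_supportFun (isCompact_lens o e R d)
  have hψ : Continuous fun u : sphere (0 : E) 1 => lensHalfWidth R d ⟪e, u⟫ :=
    (continuous_lensHalfWidth R d).comp (by fun_prop)
  have h1 : ∫ u : sphere (0 : E) 1, 2 * lensHalfWidth R d ⟪e, u⟫ ∂(volume : Measure E).toSphere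
      ≤ ∫ u : sphere (0 : E) 1, (supportFun (lens o e R d) u + supportFun (lens o e R d) (-u))
      ∂(volume : Measure E).toSphere := by
    refine integral_mono (integrable_sphere (by fun_prop)) (integrable_sphere (by fun_prop))
      fun u => ?_
    have hu : ‖(u : E)‖ = 1 := by simp
    have h1 := lensHalfWidth_le_supportFun_lens (o := o) he hu hd hdR
    have h2 := lensHalfWidth_le_supportFun_lens (o := o) he (by rwa [norm_neg] : ‖-(u : E)‖ = 1) hd hdR
    rw [inner_neg_right, inner_neg_right, ← lensHalfWidth_abs R d (-_), abs_neg,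
      lensHalfWidth_abs] at h2
    simp only
    linarith
  rw [integral_const_mul, ← two_mul_integral_supportFun (isCompact_lens o e R d)] at h1
  linarith

/-- If the mean width bound is attained then the body is a lens. -/
lemma BalancedBalls.exists_eq_lens (h : BalancedBalls K o R d w z) (hK : IsCompact K)
    (hconv : Convex ℝ K) (hball : closedBall o (R - d) ⊆ K) (hd : 0 ≤ d) (hdR : d < R)
    {e : E} (he : ‖e‖ = 1)
    (hint : ∫ u : sphere (0 : E) 1, lensHalfWidth R d ⟪e, u⟫ ∂(volume : Measure E).toSphere
      ≤ ∫ u : sphere (0 : E) 1, supportFun K u ∂(volume : Measure E).toSphere) :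
    ∃ i, K = lens o (z i) R d := by
  have hne : K.Nonempty := ⟨o, hball (mem_closedBall_self (by linarith))⟩
  have hc := continuous_supportFun hK
  obtain ⟨i⟩ := h.nonempty
  refine ⟨i, ?_⟩
  rcases hd.eq_or_lt with h0 | hd0
  · subst h0
    have h1 := h.subset i
    simp only [zero_smul, sub_zero, lens, add_zero, inter_self] at h1 hball ⊢
    exact subset_antisymm h1 hball
  -- Equality of the integrals makes the width bound sharp in every direction, in particular in
  -- direction `z i`.
  · have hwid := eq_of_le_of_integral_eq
      (f := fun u : sphere (0 : E) 1 => supportFun K u + supportFun K (-u)) (by fun_prop)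
      (continuous_sum_lensHalfWidth w z R d) (fun u => h.width_le hne hd (by simp)) (by
        rw [h.integral_sum he, ← two_mul_integral_supportFun hK]
        linarith)
    obtain ⟨j, hj⟩ := h.exists_eq_neg_of_width_eq hne hd0 hdR i
      (congrFun hwid ⟨z i, by simpa using h.norm_eq_one i⟩)
    have hsub : K ⊆ lens o (z i) R d := by
      refine subset_inter (h.subset i) ?_
      have := h.subset j
      rwa [hj, smul_neg, sub_neg_eq_add] at this
    refine subset_antisymm hsub fun x hx => ?_
    have hlc := isCompact_lens o (z i) R d
    have hcl := continuous_supportFun hlc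
    -- `K` lies in the lens, whose integral is no larger, so the support functions agree.
    have heq := eq_of_le_of_integral_eq
      (f := fun u : sphere (0 : E) 1 => supportFun K u)
      (g := fun u : sphere (0 : E) 1 => supportFun (lens o (z i) R d) u) (by fun_prop) (by fun_prop)
      (fun u => supportFun_mono hlc hne hsub u) (((balancedBalls_lens (h.norm_eq_one i)
        R d).integral_supportFun_le hlc (hne.mono hsub) hd he).trans hint)
    refine mem_of_forall_inner_le_supportFun hK hconv hne fun v hv => ?_
    have := congrFun heq ⟨v, by simpa using hv⟩
    simp only at this
    rw [this]
    exact inner_le_supportFun hlc v hx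

end BalancedBalls

lemma exists_balancedBalls {F : Type} [NormedAddCommGroup F] [InnerProductSpace ℝ F]
    [FiniteDimensional ℝ F] {K : Set F} (hK : IsClosed K) (hconv : Convex ℝ K) {R : ℝ}
    (hR : 0 < R) (hloc : LocallySupportedByBalls R K)
    (hdim : ∀ u : F, ∃ w : F, w ≠ 0 ∧ ⟪u, w⟫ = 0) {o : F} {r : ℝ} (h : IsInball K o r) :
    ∃ (ι : Type) (_ : Fintype ι) (w : ι → ℝ) (z : ι → F), BalancedBalls K o R (R - r) w z := by
  obtain ⟨ι, _, w, z, hw, hw1, hz, hwz⟩ :=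
    mem_convexHull_iff_exists_fintype.1 (zero_mem_convexHull_contact h)
  exact ⟨ι, _, w, z, hw, hw1, hwz, fun i => (hz i).1, fun i =>
    subset_closedBall_of_contact hK hconv hR hloc hdim h (hz i).1 (hz i).2⟩

end ReverseInradius

end Comparison

/-! ### Assembly in `EuclideanSpace ℝ (Fin n)`. -/

section EuclideanSpace

open MeasureTheory Metric Set
open scoped Pointwise Topology RealInnerProductSpace

namespace ReverseInradius

variable {n : ℕ}

lemma IsInball.inradius_eq {K : Set (EuclideanSpace ℝ (Fin n))} {o : EuclideanSpace ℝ (Fin n)}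
    {r : ℝ} (h : IsInball K o r) : inradius K = r :=
  IsGreatest.csSup_eq ⟨⟨h.1.le, o, h.2.1⟩, fun _ ⟨hs, c, hc⟩ => h.2.2 c _ hs hc⟩

lemma exists_ne_zero_inner_eq_zero (hn : 2 ≤ n) (u : EuclideanSpace ℝ (Fin n)) :
    ∃ w : EuclideanSpace ℝ (Fin n), w ≠ 0 ∧ ⟪u, w⟫ = 0 := by
  have hne : (ℝ ∙ u)ᗮ ≠ ⊥ := by
    intro h
    have h1 := (ℝ ∙ u).finrank_add_finrank_orthogonal
    rw [h, finrank_bot, finrank_euclideanSpace_fin] at h1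
    have h2 : Module.finrank ℝ (ℝ ∙ u) ≤ 1 := by
      simpa using finrank_span_le_card (R := ℝ) ({u} : Set (EuclideanSpace ℝ (Fin n)))
    omega
  obtain ⟨w, hw, hw0⟩ := (Submodule.ne_bot_iff _).1 hne
  exact ⟨w, hw0, Submodule.mem_orthogonal_singleton_iff_inner_right.1 hw⟩

lemma exists_eq_lens_of_isLambdaConvexLens (hn : 2 ≤ n) {lam : ℝ}
    {L : Set (EuclideanSpace ℝ (Fin n))} (hL : IsLambdaConvexLens lam L) :
    ∃ o e : EuclideanSpace ℝ (Fin n), ∃ d : ℝ, ‖e‖ = 1 ∧ 0 ≤ d ∧ d < 1 / lam ∧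
      L = lens o e (1 / lam) d := by
  have : Nonempty (Fin n) := ⟨⟨0, by omega⟩⟩
  obtain ⟨⟨-, -, x, hx⟩, c₁, c₂, rfl⟩ := hL
  obtain ⟨e, he, hce⟩ := exists_norm_eq_one_and_eq_smul (c₂ - c₁)
  set ℓ := ‖c₂ - c₁‖
  have hd : 0 ≤ ℓ / 2 := by positivity
  have h1 : c₁ + (ℓ / 2) • e - (ℓ / 2) • e = c₁ := by abel
  have h2 : c₁ + (ℓ / 2) • e + (ℓ / 2) • e = c₂ := by
    rw [add_assoc, ← add_smul, add_halves, ← hce]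
    abel
  have heq : closedBall c₁ (1 / lam) ∩ closedBall c₂ (1 / lam)
      = lens (c₁ + (ℓ / 2) • e) e (1 / lam) (ℓ / 2) := by rw [lens, h1, h2]
  refine ⟨c₁ + (ℓ / 2) • e, e, ℓ / 2, he, hd, ?_, heq⟩
  obtain ⟨s, hs, hxs⟩ := nhds_basis_closedBall.mem_iff.1 (mem_interior_iff_mem_nhds.1 hx)
  rw [heq] at hxs
  linarith [le_of_closedBall_subset_lens he hd hs.le hxs]

/-- A boundary point lies on one of the two spheres, and the corresponding ball contains the whole
lens. -/
lemma IsLambdaConvexLens.isLambdaConvexBody {lam : ℝ} {L : Set (EuclideanSpace ℝ (Fin n))}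
    (hL : IsLambdaConvexLens lam L) : IsLambdaConvexBody lam L := by
  obtain ⟨hbody, c₁, c₂, rfl⟩ := hL
  refine ⟨hbody, fun p hp => ?_⟩
  have hpL := hbody.1.isClosed.frontier_subset hp
  by_cases h1 : p ∈ sphere c₁ (1 / lam)
  · exact ⟨univ, Filter.univ_mem, c₁, h1, fun x hx => hx.2.1⟩
  by_cases h2 : p ∈ sphere c₂ (1 / lam)
  · exact ⟨univ, Filter.univ_mem, c₂, h2, fun x hx => hx.2.2⟩
  refine absurd ?_ hp.2
  have hsub : ball c₁ (1 / lam) ∩ ball c₂ (1 / lam) ⊆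
      closedBall c₁ (1 / lam) ∩ closedBall c₂ (1 / lam) :=
    inter_subset_inter ball_subset_closedBall ball_subset_closedBall
  exact interior_maximal hsub (isOpen_ball.inter isOpen_ball)
    ⟨lt_of_le_of_ne hpL.1 h1, lt_of_le_of_ne hpL.2 h2⟩

theorem intrinsicVolume_one_le_and_isLambdaConvexLens_of_eq (hn : 2 ≤ n) {lam : ℝ}
    (hlam : 0 < lam) {K L : Set (EuclideanSpace ℝ (Fin n))} (hK : IsLambdaConvexBody lam K)
    (hL : IsLambdaConvexLens lam L) (hr : inradius K = inradius L) :
    intrinsicVolume 1 K ≤ intrinsicVolume 1 L ∧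
      (intrinsicVolume 1 K = intrinsicVolume 1 L → IsLambdaConvexLens lam K) := by
  have : Nonempty (Fin n) := ⟨⟨0, by omega⟩⟩
  have hLbody := hL.1
  have hR : 0 < 1 / lam := by positivity
  obtain ⟨o', e, d, he, hd, hdR, rfl⟩ := exists_eq_lens_of_isLambdaConvexLens hn hL
  obtain ⟨⟨hKc, hKconv, hKint⟩, hloc⟩ := hK
  obtain ⟨o, r, hin⟩ := exists_isInball hKc hKint
  rw [hin.inradius_eq, (isInball_lens he hd hdR).inradius_eq] at hr
  subst hr
  obtain ⟨ι, _, w, z, hbal⟩ := exists_balancedBalls hKc.isClosed hKconv hR hloc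
    (exists_ne_zero_inner_eq_zero hn) hin
  rw [sub_sub_cancel] at hbal
  have hne : K.Nonempty := hKint.mono interior_subset
  have hVK := intrinsicVolume_one_eq (by omega) hne hKc hKconv
  have hVL := intrinsicVolume_one_eq (by omega) (hLbody.2.2.mono interior_subset)
    hLbody.1 hLbody.2.1
  have h1 := hbal.integral_supportFun_le hKc hne hd he
  have h2 := integral_lensHalfWidth_le (o := o') he hd hdR
  have hκ := unitBallVolume_pos (n - 1)
  refine ⟨?_, fun heq => ⟨⟨hKc, hKconv, hKint⟩, ?_⟩⟩
  · refine le_of_mul_le_mul_left ?_ hκ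
    rw [hVK, hVL]
    exact h1.trans h2
  · obtain ⟨i, hi⟩ := hbal.exists_eq_lens hKc hKconv hin.2.1 hd hdR he (by
      rw [← hVK, heq, hVL]
      exact h2)
    exact ⟨_, _, hi⟩

end ReverseInradius

end EuclideanSpace

theorem theoremA (n : ℕ) (hn : 2 ≤ n) (lam : ℝ) (hlam : 0 < lam)
    (K L : Set (EuclideanSpace ℝ (Fin n)))
    (hK : IsLambdaConvexBody lam K) (hL : IsLambdaConvexLens lam L)
    (hr : inradius K = inradius L) :
    intrinsicVolume 1 K ≤ intrinsicVolume 1 L ∧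
      (intrinsicVolume 1 K = intrinsicVolume 1 L ↔ IsLambdaConvexLens lam K) := by
  have h := ReverseInradius.intrinsicVolume_one_le_and_isLambdaConvexLens_of_eq hn hlam hK hL hr
  -- When `K` is a lens, the inequality applies with the roles of `K` and `L` exchanged.
  refine ⟨h.1, h.2, fun hKlens => le_antisymm h.1 ?_⟩
  exact (ReverseInradius.intrinsicVolume_one_le_and_isLambdaConvexLens_of_eq hn hlam
    (ReverseInradius.IsLambdaConvexLens.isLambdaConvexBody hL) hKlens hr.symm).1
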